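/- Let $G_0$ be a planar crystallographic group of type $pgg$, i.e. a group of isometries of the Euclidean plane $\mathbb{R}^2$ generated by the translations by two perpendicular nonzero vectors $u$ and $v$ (of equal or different lengths), the rotation of order two about some point $c$, and the glide reflection of vector $u/2$ along the line parallel to $u$ through $c+\tfrac14 v$. Let $N(G_0)$ be the normalizer of $G_0$ in the group of affine isometries of $\mathbb{R}^2$. For a set $S\subset\mathbb{R}^2$ and $p\in S$, let $\mathrm{Vor}_S(p)=\{x : |x-p|\le |x-q| \text{ for all } q\in S\}$ be the (closed) Dirichlet region of $p$, and say that two regions overlap if their interiors intersect. (a) Let $P$ and $Q$ be any two points of the plane with $Q=\tau P$ for some $\tau\in N(G_0)$. Then the number of Dirichlet regions $\mathrm{Vor}_{G_0Q}(Q')$, $Q'\in G_0Q$, that overlap $\mathrm{Vor}_{G_0P}(P)$ is at most seven. (b) Consequently, if $P$ and $Q$ are points such that $G_0P\cup G_0Q$ is contained in an orbit of $N(G_0)$, then every Dirichlet region of one of the orbits $G_0P$, $G_0Q$ overlaps at most seven Dirichlet regions of the other. -/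

import Mathlib

/-- The Euclidean plane. -/
abbrev EuclPlane : Type := EuclideanSpace ℝ (Fin 2)

/-- The group of affine isometries of the Euclidean plane. -/
abbrev PlaneIsom : Type := EuclPlane ≃ᵃⁱ[ℝ] EuclPlane

namespace PlaneGroup

noncomputable section

/-- The translation by the vector `v`. -/
def translation (v : EuclPlane) : PlaneIsom :=
  AffineIsometryEquiv.constVAdd ℝ EuclPlane v

/-- The rotation of order two (half-turn) about the point `c`. -/
def halfTurn (c : EuclPlane) : PlaneIsom :=
  AffineIsometryEquiv.pointReflection ℝ c

/-- The glide reflection with glide vector `w` along the line through `a` of direction `w`: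
the reflection in that line, followed by the translation by `w`. -/
def glideReflection (a w : EuclPlane) : PlaneIsom :=
  translation w *
    EuclideanGeometry.reflection (AffineSubspace.mk' a (Submodule.span ℝ {w}))

/-- `G` is a planar crystallographic group of type `pgg`: for two perpendicular nonzero vectors
`u`, `v` and a point `c`, it is generated by the translations by `u` and by `v`, the rotation of
order two about `c`, and the glide reflection of vector `u / 2` along the line parallel to `u`
through `c + v / 4`. The lengths of `u` and `v` may or may not be equal. -/
def IsTypePgg (G : Subgroup PlaneIsom) : Prop :=
  ∃ c u v : EuclPlane, u ≠ 0 ∧ v ≠ 0 ∧ inner ℝ u v = 0 ∧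
    G = Subgroup.closure
      {translation u, translation v, halfTurn c,
        glideReflection (c + (1 / 4 : ℝ) • v) ((1 / 2 : ℝ) • u)}

/-- The orbit `GP` of the point `P`. -/
def orbit (G : Subgroup PlaneIsom) (P : EuclPlane) : Set EuclPlane :=
  {x | ∃ g ∈ G, g P = x}

/-- The closed Dirichlet (Voronoi) region of the point `p` with respect to the set `S`. -/
def dirichletRegion (S : Set EuclPlane) (p : EuclPlane) : Set EuclPlane :=
  {x | ∀ q ∈ S, dist x p ≤ dist x q}

/-- The set of all Dirichlet regions of the points of `S` (the cells of the Voronoi diagram). -/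
def dirichletRegions (S : Set EuclPlane) : Set (Set EuclPlane) :=
  dirichletRegion S '' S

/-- Two plane regions overlap if their interiors have a common point. -/
def Overlap (A B : Set EuclPlane) : Prop :=
  (interior A ∩ interior B).Nonempty

end

end PlaneGroup

/-! Take the half-turn centre `c` as origin and `u`, `v` as axes. The squared distance becomes `α X²
+ β Y²` with `α = ‖u‖²`, `β = ‖v‖²`, and an orbit consists of the four integer families in
`orbitPoint`.

Conjugation by an element of the normalizer sends translations of the group to translations and
half-turns to half-turns. So its linear part carries `u` and `v` to lattice vectors, hence permutes
the axes up to sign (exchanging them only if `α = β`), and it carries `c` to a half-lattice point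
(`normalizerRel_of_mem_normalizer`). Half-lattice translations, sign changes and, with `α` and `β`
exchanged, the swap of coordinates preserve the whole picture, so `P = (x, y)` may be put in the
rectangle `0 ≤ x, y ≤ 1/4`. A sign change of `Q` is, within its orbit, a half-lattice translation.
Thus `Q` is one of the four points `(x + a/2, y + b/2)` or, when `α = β`, one of the four points `(y
+ a/2, x + b/2)`, with `a, b ∈ {0, 1}`.

Overlapping cells share a point strictly nearest to both centres. Comparison with the lattice
translates alone puts the two centres at distance less than one in each coordinate, which leaves 12
or 16 candidates. All but seven are excluded by a certificate in the style of Farkas' lemma: a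
nonnegative combination of two or three of the strict inequalities bounding the two cells in which
the common point cancels and the remaining constant has the wrong sign. These are the
`mem_of_inOpenCell_*` lemmas. Orbits of half-turn centres, where the certificates degenerate, are
treated apart. -/

namespace PlaneGroup

/-! ### Half-planes and open cells in coordinates -/

/-- The point with offset `(a, b)` from a centre is strictly closer to that centre than to the
point with offset `(d, e)`, for the quadratic form `α * X ^ 2 + β * Y ^ 2`. -/
def HalfPlane (α β d e a b : ℝ) : Prop :=
  2 * α * d * a + 2 * β * e * b < α * d ^ 2 + β * e ^ 2

/-- The points of a `pgg` orbit, in coordinates with respect to a half-turn centre and the two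
generating translations. -/
noncomputable def orbitPoint (r : ℝ × ℝ) : Fin 4 × ℤ × ℤ → ℝ × ℝ
  | (0, i, j) => (r.1 + i, r.2 + j)
  | (1, i, j) => (-r.1 + i, -r.2 + j)
  | (2, i, j) => (1 / 2 + r.1 + i, 1 / 2 - r.2 + j)
  | (3, i, j) => (1 / 2 - r.1 + i, 1 / 2 + r.2 + j)

/-- `(s, t)` is strictly closer to `(x, y)` than to the other points of the orbit of `(x, y)`,
expressed through the offsets of those points. -/
structure InOpenCell (α β x y s t : ℝ) : Prop where
  h0 : ∀ i j : ℤ, (i, j) ≠ (0, 0) → HalfPlane α β i j (s - x) (t - y)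
  h1 : ∀ i j : ℤ, HalfPlane α β (-2 * x + i) (-2 * y + j) (s - x) (t - y)
  h2 : ∀ i j : ℤ, HalfPlane α β (1 / 2 + i) (1 / 2 - 2 * y + j) (s - x) (t - y)
  h3 : ∀ i j : ℤ, HalfPlane α β (1 / 2 - 2 * x + i) (1 / 2 + j) (s - x) (t - y)

/-- For opposite offsets the unknown point cancels from the left side: two half-planes with parallel
boundaries facing away from each other. -/
theorem HalfPlane.add {α β d₁ e₁ a₁ b₁ d₂ e₂ a₂ b₂ : ℝ}
    (h₁ : HalfPlane α β d₁ e₁ a₁ b₁) (h₂ : HalfPlane α β d₂ e₂ a₂ b₂) :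
    2 * α * d₁ * a₁ + 2 * β * e₁ * b₁ + (2 * α * d₂ * a₂ + 2 * β * e₂ * b₂) <
      α * d₁ ^ 2 + β * e₁ ^ 2 + (α * d₂ ^ 2 + β * e₂ ^ 2) :=
  add_lt_add h₁ h₂

/-- Farkas certificate for three half-planes. The weights are chosen so that the weighted offsets
sum to zero; one positive weight is enough to keep the inequality strict. -/
theorem HalfPlane.combine {α β d₁ e₁ a₁ b₁ d₂ e₂ a₂ b₂ d₃ e₃ a₃ b₃ : ℝ} (l₁ l₂ l₃ : ℝ)
    (h₁ : HalfPlane α β d₁ e₁ a₁ b₁) (h₂ : HalfPlane α β d₂ e₂ a₂ b₂)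
    (h₃ : HalfPlane α β d₃ e₃ a₃ b₃) (hl₁ : 0 ≤ l₁) (hl₂ : 0 ≤ l₂) (hl₃ : 0 ≤ l₃)
    (hl : 0 < l₁ + l₂ + l₃) :
    l₁ * (2 * α * d₁ * a₁ + 2 * β * e₁ * b₁) + l₂ * (2 * α * d₂ * a₂ + 2 * β * e₂ * b₂) +
        l₃ * (2 * α * d₃ * a₃ + 2 * β * e₃ * b₃) <
      l₁ * (α * d₁ ^ 2 + β * e₁ ^ 2) + l₂ * (α * d₂ ^ 2 + β * e₂ ^ 2) +
        l₃ * (α * d₃ ^ 2 + β * e₃ ^ 2) := by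
  unfold HalfPlane at h₁ h₂ h₃
  have k₁ := mul_le_mul_of_nonneg_left h₁.le hl₁
  have k₂ := mul_le_mul_of_nonneg_left h₂.le hl₂
  have k₃ := mul_le_mul_of_nonneg_left h₃.le hl₃
  rcases hl₁.eq_or_lt with e₁ | p₁
  · rcases hl₂.eq_or_lt with e₂ | p₂
    · have p₃ : 0 < l₃ := by linarith
      linarith [mul_lt_mul_of_pos_left h₃ p₃]
    · linarith [mul_lt_mul_of_pos_left h₂ p₂]
  · linarith [mul_lt_mul_of_pos_left h₁ p₁]

/-- The translates of the centre confine its open cell to a rectangle. -/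
theorem offset_bounds {α β a b : ℝ} (hα : 0 < α) (hβ : 0 < β)
    (h : ∀ i j : ℤ, (i, j) ≠ (0, 0) → HalfPlane α β i j a b) :
    (-(1 / 2) < a ∧ a < 1 / 2) ∧ (-(1 / 2) < b ∧ b < 1 / 2) := by
  have h₁ := h 1 0 (by decide)
  have h₂ := h (-1) 0 (by decide)
  have h₃ := h 0 1 (by decide)
  have h₄ := h 0 (-1) (by decide)
  unfold HalfPlane at h₁ h₂ h₃ h₄
  push_cast at h₁ h₂ h₃ h₄
  refine ⟨⟨?_, ?_⟩, ?_, ?_⟩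
  · by_contra! hc
    nlinarith
  · by_contra! hc
    nlinarith
  · by_contra! hc
    nlinarith
  · by_contra! hc
    nlinarith

/-- Two centres whose open cells have a common point differ by less than one in each
coordinate. -/
theorem centre_bounds {α β x y x' y' s t : ℝ} (hα : 0 < α) (hβ : 0 < β)
    (h : ∀ i j : ℤ, (i, j) ≠ (0, 0) → HalfPlane α β i j (s - x) (t - y))
    (h' : ∀ i j : ℤ, (i, j) ≠ (0, 0) → HalfPlane α β i j (s - x') (t - y')) :
    (x - 1 < x' ∧ x' < x + 1) ∧ (y - 1 < y' ∧ y' < y + 1) := by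
  obtain ⟨⟨h₁, h₂⟩, h₃, h₄⟩ := offset_bounds hα hβ h
  obtain ⟨⟨k₁, k₂⟩, k₃, k₄⟩ := offset_bounds hα hβ h'
  refine ⟨⟨?_, ?_⟩, ?_, ?_⟩ <;> linarith

/-! ### Excluding candidates: images under half-lattice translations -/

theorem int_mem_Ioo_of_cast {i a b : ℤ} (h₁ : (a : ℝ) < i) (h₂ : (i : ℝ) < b) : a < i ∧ i < b :=
  ⟨by exact_mod_cast h₁, by exact_mod_cast h₂⟩

/-- Twelve candidates pass the coordinate bounds, and each of the five others than those listed is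
separated from the cell of `(x, y)` by two parallel boundary lines, for every `α` and `β`. -/
theorem mem_of_inOpenCell_shift_fst {α β x y s t : ℝ}
    (hα : 0 < α) (hβ : 0 < β) (hx₀ : 0 ≤ x) (hx : x ≤ 1 / 4) (hy₀ : 0 ≤ y) (hy : y ≤ 1 / 4)
    (P : InOpenCell α β x y s t) {k : Fin 4} {i j : ℤ}
    (Q : InOpenCell α β (orbitPoint (x + 1 / 2, y) (k, i, j)).1 (orbitPoint (x + 1 / 2, y) (k, i, j)).2 s t) :
    (k, i, j) ∈ ([(0, -1, 0), (0, 0, 0), (1, 1, 0), (2, -1, -1), (2, -1, 0), (3, 0, -1), (3, 0, 0)] : List (Fin 4 × ℤ × ℤ)) := by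
  obtain ⟨⟨hi₁, hi₂⟩, hj₁, hj₂⟩ := centre_bounds hα hβ P.h0 Q.h0
  match k, Q, hi₁, hi₂, hj₁, hj₂ with
  | 0, Q, hi₁, hi₂, hj₁, hj₂ =>
    change InOpenCell α β (x + 1 / 2 + i) (y + j) s t at Q
    simp only [orbitPoint] at hi₁ hi₂ hj₁ hj₂
    -- Both ends are exclusive: the centres differ by `(1/2 + i, j)`, so `i` is `-1` or `0` and `j`
    -- is `0`.
    obtain ⟨hil, hiu⟩ := int_mem_Ioo_of_cast (i := i) (a := -2) (b := 1)
      (by push_cast; linarith) (by push_cast; linarith)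
    obtain ⟨hjl, hju⟩ := int_mem_Ioo_of_cast (i := j) (a := -1) (b := 1)
      (by push_cast; linarith) (by push_cast; linarith)
    clear hi₁ hi₂ hj₁ hj₂
    interval_cases i <;> interval_cases j
    · decide
    · decide
  | 1, Q, hi₁, hi₂, hj₁, hj₂ =>
    change InOpenCell α β (-(x + 1 / 2) + i) (-y + j) s t at Q
    simp only [orbitPoint] at hi₁ hi₂ hj₁ hj₂
    obtain ⟨hil, hiu⟩ := int_mem_Ioo_of_cast (i := i) (a := -1) (b := 2)
      (by push_cast; linarith) (by push_cast; linarith)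
    obtain ⟨hjl, hju⟩ := int_mem_Ioo_of_cast (i := j) (a := -1) (b := 2)
      (by push_cast; linarith) (by push_cast; linarith)
    clear hi₁ hi₂ hj₁ hj₂
    interval_cases i <;> interval_cases j
    · exfalso
      -- The offsets are `(-2x, -2y)` and `(2x, 2y)`; what remains is `2αx < 0`.
      have h := HalfPlane.add (P.h1 0 0) (Q.h1 (-1) 0)
      push_cast at h
      have kα : 0 ≤ α * (x) := mul_nonneg hα.le (by linarith)
      linarith only [h, kα]
    · exfalso
      have h := HalfPlane.add (P.h1 0 1) (Q.h1 (-1) 1)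
      push_cast at h
      have kα : 0 ≤ α * (x) := mul_nonneg hα.le (by linarith)
      linarith only [h, kα]
    · decide
    · exfalso
      have h := HalfPlane.add (P.h3 0 0) (Q.h3 0 (-1))
      push_cast at h
      have kβ : 0 ≤ β * (1 / 4 - y) := mul_nonneg hβ.le (by linarith)
      linarith only [h, kβ]
  | 2, Q, hi₁, hi₂, hj₁, hj₂ =>
    change InOpenCell α β (1 / 2 + (x + 1 / 2) + i) (1 / 2 - y + j) s t at Q
    simp only [orbitPoint] at hi₁ hi₂ hj₁ hj₂
    obtain ⟨hil, hiu⟩ := int_mem_Ioo_of_cast (i := i) (a := -2) (b := 0)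
      (by push_cast; linarith) (by push_cast; linarith)
    obtain ⟨hjl, hju⟩ := int_mem_Ioo_of_cast (i := j) (a := -2) (b := 1)
      (by push_cast; linarith) (by push_cast; linarith)
    clear hi₁ hi₂ hj₁ hj₂
    interval_cases i; interval_cases j
    · decide
    · decide
  | 3, Q, hi₁, hi₂, hj₁, hj₂ =>
    change InOpenCell α β (1 / 2 - (x + 1 / 2) + i) (1 / 2 + y + j) s t at Q
    simp only [orbitPoint] at hi₁ hi₂ hj₁ hj₂
    obtain ⟨hil, hiu⟩ := int_mem_Ioo_of_cast (i := i) (a := -1) (b := 2)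
      (by push_cast; linarith) (by push_cast; linarith)
    obtain ⟨hjl, hju⟩ := int_mem_Ioo_of_cast (i := j) (a := -2) (b := 1)
      (by push_cast; linarith) (by push_cast; linarith)
    clear hi₁ hi₂ hj₁ hj₂
    interval_cases i <;> interval_cases j
    · decide
    · decide
    · exfalso
      have h := HalfPlane.add (P.h3 0 (-1)) (Q.h3 1 0)
      push_cast at h
      have kα : 0 ≤ α * (1 / 4 - x) := mul_nonneg hα.le (by linarith)
      linarith only [h, kα]
    · exfalso
      have h := HalfPlane.add (P.h3 0 0) (Q.h3 1 (-1))
      push_cast at h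
      have kα : 0 ≤ α * (1 / 4 - x) := mul_nonneg hα.le (by linarith)
      linarith only [h, kα]

/-- Again five of twelve candidates are excluded. For the two diagonal translates parallel lines do
not suffice and three half-planes are combined. The coefficients of `α` and `β` left over have the
right sign separately, so the weights need not depend on the shape of the lattice. -/
theorem mem_of_inOpenCell_shift_both {α β x y s t : ℝ}
    (hα : 0 < α) (hβ : 0 < β) (hx₀ : 0 ≤ x) (hx : x ≤ 1 / 4) (hy₀ : 0 ≤ y) (hy : y ≤ 1 / 4)
    (P : InOpenCell α β x y s t) {k : Fin 4} {i j : ℤ}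
    (Q : InOpenCell α β (orbitPoint (x + 1 / 2, y + 1 / 2) (k, i, j)).1 (orbitPoint (x + 1 / 2, y + 1 / 2) (k, i, j)).2 s t) :
    (k, i, j) ∈ ([(0, -1, 0), (0, 0, -1), (1, 1, 1), (2, -1, 0), (2, -1, 1), (3, 0, -1), (3, 1, -1)] : List (Fin 4 × ℤ × ℤ)) := by
  obtain ⟨⟨hi₁, hi₂⟩, hj₁, hj₂⟩ := centre_bounds hα hβ P.h0 Q.h0
  match k, Q, hi₁, hi₂, hj₁, hj₂ with
  | 0, Q, hi₁, hi₂, hj₁, hj₂ =>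
    change InOpenCell α β (x + 1 / 2 + i) (y + 1 / 2 + j) s t at Q
    simp only [orbitPoint] at hi₁ hi₂ hj₁ hj₂
    obtain ⟨hil, hiu⟩ := int_mem_Ioo_of_cast (i := i) (a := -2) (b := 1)
      (by push_cast; linarith) (by push_cast; linarith)
    obtain ⟨hjl, hju⟩ := int_mem_Ioo_of_cast (i := j) (a := -2) (b := 1)
      (by push_cast; linarith) (by push_cast; linarith)
    clear hi₁ hi₂ hj₁ hj₂
    interval_cases i <;> interval_cases j
    · exfalso
      -- The weights are the solution, up to scale, of the two equations cancelling the offsets. The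
      -- order of `x` and `y` decides which glide images give nonnegative weights; the other case is
      -- the mirror image, with `h3` in place of `h2`.
      rcases le_total x y with hxy | hxy
      · have h := HalfPlane.combine (1 / 2 - 2 * y) (y - x + 4 * x * y) (y + x - 4 * x * y)
          (P.h1 0 0) (P.h2 (-1) 0) (Q.h2 0 (-1))
          (by linarith) (by nlinarith) (by nlinarith) (by linarith)
        push_cast at h
        -- The leftovers are `4x(1/4 - x)(1/4 - y)` for `α` and `4x(1/4 - y)²` for `β`.
        have kα : 0 ≤ α * (1 / 4 * x - x * y - x ^ 2 + 4 * x ^ 2 * y) := mul_nonneg hα.le (by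
          nlinarith only [mul_nonneg (mul_nonneg hx₀ (sub_nonneg.2 hx)) (sub_nonneg.2 hy)])
        have kβ : 0 ≤ β * (1 / 4 * x - 2 * x * y + 4 * x * y ^ 2) := mul_nonneg hβ.le (by nlinarith)
        linarith only [h, kα, kβ]
      · have h := HalfPlane.combine (1 / 2 - 2 * x) (-y + x + 4 * x * y) (y + x - 4 * x * y)
          (P.h1 0 0) (P.h3 0 (-1)) (Q.h3 (-1) 0)
          (by linarith) (by nlinarith) (by nlinarith) (by linarith)
        push_cast at h
        have kα : 0 ≤ α * (1 / 4 * y - 2 * x * y + 4 * x ^ 2 * y) := mul_nonneg hα.le (by nlinarith)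
        have kβ : 0 ≤ β * (1 / 4 * y - y ^ 2 - x * y + 4 * x * y ^ 2) := mul_nonneg hβ.le (by
          nlinarith only [mul_nonneg (mul_nonneg hy₀ (sub_nonneg.2 hx)) (sub_nonneg.2 hy)])
        linarith only [h, kα, kβ]
    · decide
    · decide
    · exfalso
      rcases le_total x y with hxy | hxy
      · have h := HalfPlane.combine (y + x - 4 * x * y) (1 / 2 - 2 * y) (y - x + 4 * x * y)
          (P.h2 0 0) (Q.h1 1 1) (Q.h2 (-1) 1)
          (by nlinarith) (by linarith) (by nlinarith) (by linarith)
        push_cast at h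
        have kα : 0 ≤ α * (1 / 4 * x - x * y - x ^ 2 + 4 * x ^ 2 * y) := mul_nonneg hα.le (by
          nlinarith only [mul_nonneg (mul_nonneg hx₀ (sub_nonneg.2 hx)) (sub_nonneg.2 hy)])
        have kβ : 0 ≤ β * (1 / 4 * x - 2 * x * y + 4 * x * y ^ 2) := mul_nonneg hβ.le (by nlinarith)
        linarith only [h, kα, kβ]
      · have h := HalfPlane.combine (y + x - 4 * x * y) (1 / 2 - 2 * x) (-y + x + 4 * x * y)
          (P.h3 0 0) (Q.h1 1 1) (Q.h3 1 (-1))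
          (by nlinarith) (by linarith) (by nlinarith) (by linarith)
        push_cast at h
        have kα : 0 ≤ α * (1 / 4 * y - 2 * x * y + 4 * x ^ 2 * y) := mul_nonneg hα.le (by nlinarith)
        have kβ : 0 ≤ β * (1 / 4 * y - y ^ 2 - x * y + 4 * x * y ^ 2) := mul_nonneg hβ.le (by
          nlinarith only [mul_nonneg (mul_nonneg hy₀ (sub_nonneg.2 hx)) (sub_nonneg.2 hy)])
        linarith only [h, kα, kβ]
  | 1, Q, hi₁, hi₂, hj₁, hj₂ =>
    change InOpenCell α β (-(x + 1 / 2) + i) (-(y + 1 / 2) + j) s t at Q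
    simp only [orbitPoint] at hi₁ hi₂ hj₁ hj₂
    obtain ⟨hil, hiu⟩ := int_mem_Ioo_of_cast (i := i) (a := -1) (b := 2)
      (by push_cast; linarith) (by push_cast; linarith)
    obtain ⟨hjl, hju⟩ := int_mem_Ioo_of_cast (i := j) (a := -1) (b := 2)
      (by push_cast; linarith) (by push_cast; linarith)
    clear hi₁ hi₂ hj₁ hj₂
    interval_cases i <;> interval_cases j
    · exfalso
      have h := HalfPlane.add (P.h2 (-1) (-1)) (Q.h2 0 (-1))
      push_cast at h
      have kα : 0 ≤ α * (x) := mul_nonneg hα.le (by linarith)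
      linarith only [h, kα]
    · exfalso
      have h := HalfPlane.add (P.h2 (-1) 0) (Q.h2 0 0)
      push_cast at h
      have kα : 0 ≤ α * (x) := mul_nonneg hα.le (by linarith)
      linarith only [h, kα]
    · exfalso
      have h := HalfPlane.add (P.h3 0 (-1)) (Q.h3 0 0)
      push_cast at h
      have kβ : 0 ≤ β * (y) := mul_nonneg hβ.le (by linarith)
      linarith only [h, kβ]
    · decide
  | 2, Q, hi₁, hi₂, hj₁, hj₂ =>
    change InOpenCell α β (1 / 2 + (x + 1 / 2) + i) (1 / 2 - (y + 1 / 2) + j) s t at Q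
    simp only [orbitPoint] at hi₁ hi₂ hj₁ hj₂
    obtain ⟨hil, hiu⟩ := int_mem_Ioo_of_cast (i := i) (a := -2) (b := 0)
      (by push_cast; linarith) (by push_cast; linarith)
    obtain ⟨hjl, hju⟩ := int_mem_Ioo_of_cast (i := j) (a := -1) (b := 2)
      (by push_cast; linarith) (by push_cast; linarith)
    clear hi₁ hi₂ hj₁ hj₂
    interval_cases i; interval_cases j
    · decide
    · decide
  | 3, Q, hi₁, hi₂, hj₁, hj₂ =>
    change InOpenCell α β (1 / 2 - (x + 1 / 2) + i) (1 / 2 + (y + 1 / 2) + j) s t at Q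
    simp only [orbitPoint] at hi₁ hi₂ hj₁ hj₂
    obtain ⟨hil, hiu⟩ := int_mem_Ioo_of_cast (i := i) (a := -1) (b := 2)
      (by push_cast; linarith) (by push_cast; linarith)
    obtain ⟨hjl, hju⟩ := int_mem_Ioo_of_cast (i := j) (a := -2) (b := 0)
      (by push_cast; linarith) (by push_cast; linarith)
    clear hi₁ hi₂ hj₁ hj₂
    interval_cases i <;> interval_cases j
    · decide
    · decide

/-! ### Excluding candidates: images exchanging the axes of a square lattice -/

/-- Equal weights may be scaled to `1`. Here and in the next three lemmas sixteen candidates pass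
the coordinate bounds and nine are excluded. The order `x ≤ y` keeps weights such as `y - x`
nonnegative, and `0 < y` keeps their sum positive where all of them vanish at the origin. -/
theorem mem_of_inOpenCell_swap {x y s t : ℝ}
    (hx₀ : 0 ≤ x) (hxy : x ≤ y) (hy₀ : 0 < y) (hy : y ≤ 1 / 4)
    (P : InOpenCell 1 1 x y s t) {k : Fin 4} {i j : ℤ}
    (Q : InOpenCell 1 1 (orbitPoint (y, x) (k, i, j)).1 (orbitPoint (y, x) (k, i, j)).2 s t) :
    (k, i, j) ∈ ([(0, 0, 0), (1, 0, 0), (1, 0, 1), (1, 1, 0), (2, -1, 0), (2, 0, 0), (3, 0, 0)] : List (Fin 4 × ℤ × ℤ)) := by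
  obtain ⟨⟨hi₁, hi₂⟩, hj₁, hj₂⟩ := centre_bounds one_pos one_pos P.h0 Q.h0
  match k, Q, hi₁, hi₂, hj₁, hj₂ with
  | 0, Q, hi₁, hi₂, hj₁, hj₂ =>
    change InOpenCell 1 1 (y + i) (x + j) s t at Q
    simp only [orbitPoint] at hi₁ hi₂ hj₁ hj₂
    obtain ⟨hil, hiu⟩ := int_mem_Ioo_of_cast (i := i) (a := -2) (b := 1)
      (by push_cast; linarith) (by push_cast; linarith)
    obtain ⟨hjl, hju⟩ := int_mem_Ioo_of_cast (i := j) (a := -1) (b := 2)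
      (by push_cast; linarith) (by push_cast; linarith)
    clear hi₁ hi₂ hj₁ hj₂
    interval_cases i <;> interval_cases j
    · exfalso
      have h := HalfPlane.combine (1 / 2) (1 / 2 - y - x) (y + x)
        (P.h2 (-1) 0) (Q.h2 0 (-1)) (Q.h2 0 0)
        (by linarith) (by linarith) (by linarith) (by linarith)
      push_cast at h
      have k : 0 ≤ x * y + x ^ 2 := by nlinarith
      linarith only [h, k]
    · exfalso
      have h := HalfPlane.combine (1 / 2) (2 * x) (1)
        (P.h0 (-1) 1 (by decide)) (P.h0 0 1 (by decide)) (Q.h2 0 1)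
        (by linarith) (by linarith) (by linarith) (by linarith)
      push_cast at h
      have k : 0 ≤ 1 / 4 - y + x - 2 * x * y := by nlinarith
      linarith only [h, k]
    · decide
    · exfalso
      have h := HalfPlane.combine (1 / 2 - y - x) (y + x) (1 / 2)
        (P.h3 (-1) 0) (P.h3 0 0) (Q.h3 0 (-1))
        (by linarith) (by linarith) (by linarith) (by linarith)
      push_cast at h
      have k : 0 ≤ x * y + x ^ 2 := by nlinarith
      linarith only [h, k]
  | 1, Q, hi₁, hi₂, hj₁, hj₂ =>
    change InOpenCell 1 1 (-y + i) (-x + j) s t at Q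
    simp only [orbitPoint] at hi₁ hi₂ hj₁ hj₂
    obtain ⟨hil, hiu⟩ := int_mem_Ioo_of_cast (i := i) (a := -1) (b := 2)
      (by push_cast; linarith) (by push_cast; linarith)
    obtain ⟨hjl, hju⟩ := int_mem_Ioo_of_cast (i := j) (a := -1) (b := 2)
      (by push_cast; linarith) (by push_cast; linarith)
    clear hi₁ hi₂ hj₁ hj₂
    interval_cases i <;> interval_cases j
    · decide
    · decide
    · decide
    · exfalso
      have h := HalfPlane.combine (y - x) (1 / 2) (1 / 2)
        (P.h0 0 1 (by decide)) (P.h2 0 0) (Q.h2 (-1) 1)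
        (by linarith) (by linarith) (by linarith) (by linarith)
      push_cast at h
      have k : 0 ≤ 1 / 4 - 1 / 2 * y - y ^ 2 - 1 / 2 * x + x * y := by nlinarith
      linarith only [h, k]
  | 2, Q, hi₁, hi₂, hj₁, hj₂ =>
    change InOpenCell 1 1 (1 / 2 + y + i) (1 / 2 - x + j) s t at Q
    simp only [orbitPoint] at hi₁ hi₂ hj₁ hj₂
    obtain ⟨hil, hiu⟩ := int_mem_Ioo_of_cast (i := i) (a := -2) (b := 1)
      (by push_cast; linarith) (by push_cast; linarith)
    obtain ⟨hjl, hju⟩ := int_mem_Ioo_of_cast (i := j) (a := -2) (b := 1)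
      (by push_cast; linarith) (by push_cast; linarith)
    clear hi₁ hi₂ hj₁ hj₂
    interval_cases i <;> interval_cases j
    · exfalso
      -- The half-turn offset `(-2x, -2y)` is cancelled by `2y` times `(0, 1)` plus `2x` times `(1,
      -- 0)`.
      have h := HalfPlane.combine (1) (2 * y) (2 * x)
        (P.h1 0 0) (Q.h0 0 1 (by decide)) (Q.h0 1 0 (by decide))
        (by linarith) (by linarith) (by linarith) (by linarith)
      push_cast at h
      linarith only [h]
    · decide
    · exfalso
      have h := HalfPlane.combine (2 * x) (2 * y) (1)
        (P.h0 0 (-1) (by decide)) (P.h0 1 0 (by decide)) (Q.h1 1 (-1))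
        (by linarith) (by linarith) (by linarith) (by linarith)
      push_cast at h
      linarith only [h]
    · decide
  | 3, Q, hi₁, hi₂, hj₁, hj₂ =>
    change InOpenCell 1 1 (1 / 2 - y + i) (1 / 2 + x + j) s t at Q
    simp only [orbitPoint] at hi₁ hi₂ hj₁ hj₂
    obtain ⟨hil, hiu⟩ := int_mem_Ioo_of_cast (i := i) (a := -2) (b := 1)
      (by push_cast; linarith) (by push_cast; linarith)
    obtain ⟨hjl, hju⟩ := int_mem_Ioo_of_cast (i := j) (a := -2) (b := 1)
      (by push_cast; linarith) (by push_cast; linarith)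
    clear hi₁ hi₂ hj₁ hj₂
    interval_cases i <;> interval_cases j
    · exfalso
      have h := HalfPlane.combine (1) (2 * y) (2 * x)
        (P.h1 0 0) (Q.h0 0 1 (by decide)) (Q.h0 1 0 (by decide))
        (by linarith) (by linarith) (by linarith) (by linarith)
      push_cast at h
      linarith only [h]
    · exfalso
      have h := HalfPlane.combine (2 * y) (2 * x) (1)
        (P.h0 (-1) 0 (by decide)) (P.h0 0 1 (by decide)) (Q.h1 (-1) 1)
        (by linarith) (by linarith) (by linarith) (by linarith)
      push_cast at h
      linarith only [h]
    · exfalso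
      have h := HalfPlane.combine (y + x - 4 * x * y) (y - x) (2 * x - 4 * x ^ 2)
        (P.h3 0 (-1)) (Q.h2 (-1) (-1)) (Q.h3 0 0)
        (by nlinarith) (by linarith) (by nlinarith) (by nlinarith)
      push_cast at h
      -- This is `x(y - x)(1 - 2(x + y))`.
      have k : 0 ≤ x * y - 2 * x * y ^ 2 - x ^ 2 + 2 * x ^ 3 := by
          nlinarith only [mul_nonneg (mul_nonneg hx₀ (sub_nonneg.2 hxy)) (by linarith : 0 ≤ 1 - 2 * (x + y))]
      linarith only [h, k]
    · decide

theorem mem_of_inOpenCell_swap_shift_fst {x y s t : ℝ}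
    (hx₀ : 0 ≤ x) (hxy : x ≤ y) (hy₀ : 0 < y) (hy : y ≤ 1 / 4)
    (P : InOpenCell 1 1 x y s t) {k : Fin 4} {i j : ℤ}
    (Q : InOpenCell 1 1 (orbitPoint (y + 1 / 2, x) (k, i, j)).1 (orbitPoint (y + 1 / 2, x) (k, i, j)).2 s t) :
    (k, i, j) ∈ ([(0, -1, 0), (0, 0, 0), (1, 1, 0), (2, -1, -1), (2, -1, 0), (3, 0, 0), (3, 1, 0)] : List (Fin 4 × ℤ × ℤ)) := by
  obtain ⟨⟨hi₁, hi₂⟩, hj₁, hj₂⟩ := centre_bounds one_pos one_pos P.h0 Q.h0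
  match k, Q, hi₁, hi₂, hj₁, hj₂ with
  | 0, Q, hi₁, hi₂, hj₁, hj₂ =>
    change InOpenCell 1 1 (y + 1 / 2 + i) (x + j) s t at Q
    simp only [orbitPoint] at hi₁ hi₂ hj₁ hj₂
    obtain ⟨hil, hiu⟩ := int_mem_Ioo_of_cast (i := i) (a := -2) (b := 1)
      (by push_cast; linarith) (by push_cast; linarith)
    obtain ⟨hjl, hju⟩ := int_mem_Ioo_of_cast (i := j) (a := -1) (b := 2)
      (by push_cast; linarith) (by push_cast; linarith)
    clear hi₁ hi₂ hj₁ hj₂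
    interval_cases i <;> interval_cases j
    · decide
    · exfalso
      have h := HalfPlane.combine (1 / 2 - 2 * y) (1 / 2) (1)
        (P.h0 (-1) 0 (by decide)) (P.h0 0 1 (by decide)) (Q.h3 (-1) (-1))
        (by linarith) (by linarith) (by linarith) (by linarith)
      push_cast at h
      have k : 0 ≤ x - 2 * x * y := by nlinarith
      linarith only [h, k]
    · decide
    · exfalso
      have h := HalfPlane.combine (1 - 2 * y) (1 / 2 - y - x) (2 * x)
        (P.h3 0 0) (Q.h0 (-1) (-1) (by decide)) (Q.h3 1 (-1))
        (by linarith) (by linarith) (by linarith) (by linarith)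
      push_cast at h
      have k : 0 ≤ 1 / 2 * x := by linarith
      linarith only [h, k]
  | 1, Q, hi₁, hi₂, hj₁, hj₂ =>
    change InOpenCell 1 1 (-(y + 1 / 2) + i) (-x + j) s t at Q
    simp only [orbitPoint] at hi₁ hi₂ hj₁ hj₂
    obtain ⟨hil, hiu⟩ := int_mem_Ioo_of_cast (i := i) (a := -1) (b := 2)
      (by push_cast; linarith) (by push_cast; linarith)
    obtain ⟨hjl, hju⟩ := int_mem_Ioo_of_cast (i := j) (a := -1) (b := 2)
      (by push_cast; linarith) (by push_cast; linarith)
    clear hi₁ hi₂ hj₁ hj₂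
    interval_cases i <;> interval_cases j
    · exfalso
      have h := HalfPlane.combine (y - 4 * y ^ 2 + x) (y + 4 * y ^ 2 - x) (1 / 2)
        (P.h2 (-1) (-1)) (P.h2 (-1) 0) (Q.h1 (-1) 0)
        (by nlinarith) (by nlinarith) (by linarith) (by linarith)
      push_cast at h
      have k : 0 ≤ 4 * y ^ 3 := by nlinarith
      linarith only [h, k]
    · exfalso
      have h := HalfPlane.combine (y - x) (2 * x) (2 * y)
        (P.h0 (-1) 1 (by decide)) (P.h2 (-1) 0) (Q.h2 0 1)
        (by linarith) (by linarith) (by linarith) (by linarith)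
      push_cast at h
      have k : 0 ≤ 1 / 2 * x := by linarith
      linarith only [h, k]
    · decide
    · exfalso
      have h := HalfPlane.combine (y + x - 4 * x * y) (y - x) (2 * x - 4 * x ^ 2)
        (P.h3 0 0) (Q.h2 (-1) 1) (Q.h3 0 (-1))
        (by nlinarith) (by linarith) (by nlinarith) (by nlinarith)
      push_cast at h
      have k : 0 ≤ 1 / 4 * y - y ^ 2 + 1 / 4 * x - x * y + 2 * x * y ^ 2 - x ^ 2 + 2 * x ^ 3 := by nlinarith
      linarith only [h, k]
  | 2, Q, hi₁, hi₂, hj₁, hj₂ =>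
    change InOpenCell 1 1 (1 / 2 + (y + 1 / 2) + i) (1 / 2 - x + j) s t at Q
    simp only [orbitPoint] at hi₁ hi₂ hj₁ hj₂
    obtain ⟨hil, hiu⟩ := int_mem_Ioo_of_cast (i := i) (a := -3) (b := 0)
      (by push_cast; linarith) (by push_cast; linarith)
    obtain ⟨hjl, hju⟩ := int_mem_Ioo_of_cast (i := j) (a := -2) (b := 1)
      (by push_cast; linarith) (by push_cast; linarith)
    clear hi₁ hi₂ hj₁ hj₂
    interval_cases i <;> interval_cases j
    · exfalso
      have h := HalfPlane.combine (1) (2 * y) (2 * x)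
        (P.h1 0 0) (Q.h0 0 1 (by decide)) (Q.h0 1 0 (by decide))
        (by linarith) (by linarith) (by linarith) (by linarith)
      push_cast at h
      have k : 0 ≤ x := by linarith
      linarith only [h, k]
    · exfalso
      have h := HalfPlane.combine (1) (1 / 2 - 2 * y) (1 / 2)
        (P.h2 (-1) 0) (Q.h0 0 (-1) (by decide)) (Q.h0 1 0 (by decide))
        (by linarith) (by linarith) (by linarith) (by linarith)
      push_cast at h
      have k : 0 ≤ 2 * x * y := by nlinarith
      linarith only [h, k]
    · decide
    · decide
  | 3, Q, hi₁, hi₂, hj₁, hj₂ =>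
    change InOpenCell 1 1 (1 / 2 - (y + 1 / 2) + i) (1 / 2 + x + j) s t at Q
    simp only [orbitPoint] at hi₁ hi₂ hj₁ hj₂
    obtain ⟨hil, hiu⟩ := int_mem_Ioo_of_cast (i := i) (a := -1) (b := 2)
      (by push_cast; linarith) (by push_cast; linarith)
    obtain ⟨hjl, hju⟩ := int_mem_Ioo_of_cast (i := j) (a := -2) (b := 1)
      (by push_cast; linarith) (by push_cast; linarith)
    clear hi₁ hi₂ hj₁ hj₂
    interval_cases i <;> interval_cases j
    · exfalso
      have h := HalfPlane.combine (1 / 2 - y - x + 4 * x * y) (y - 4 * y ^ 2 + x) (y - x + 4 * x ^ 2)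
        (P.h1 0 0) (Q.h2 0 (-1)) (Q.h3 (-1) 0)
        (by nlinarith) (by nlinarith) (by nlinarith) (by nlinarith)
      push_cast at h
      -- This is `(y - x)(y(1 - 2y) + 2x²)`.
      have k : 0 ≤ y ^ 2 - 2 * y ^ 3 - x * y + 2 * x * y ^ 2 + 2 * x ^ 2 * y - 2 * x ^ 3 := by
          nlinarith only [mul_nonneg (sub_nonneg.2 hxy) (by nlinarith : 0 ≤ y * (1 - 2 * y) + 2 * x ^ 2)]
      linarith only [h, k]
    · decide
    · exfalso
      have h := HalfPlane.combine (2 * y) (y - x) (2 * x)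
        (P.h3 0 (-1)) (Q.h0 (-1) 1 (by decide)) (Q.h3 1 0)
        (by linarith) (by linarith) (by linarith) (by linarith)
      push_cast at h
      have k : 0 ≤ 1 / 2 * x - 2 * x * y := by nlinarith
      linarith only [h, k]
    · decide

theorem mem_of_inOpenCell_swap_shift_snd {x y s t : ℝ}
    (hx₀ : 0 ≤ x) (hxy : x ≤ y) (hy₀ : 0 < y) (hy : y ≤ 1 / 4)
    (P : InOpenCell 1 1 x y s t) {k : Fin 4} {i j : ℤ}
    (Q : InOpenCell 1 1 (orbitPoint (y, x + 1 / 2) (k, i, j)).1 (orbitPoint (y, x + 1 / 2) (k, i, j)).2 s t) :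
    (k, i, j) ∈ ([(0, 0, -1), (0, 0, 0), (1, 0, 1), (2, -1, 0), (2, -1, 1), (3, -1, -1), (3, 0, -1)] : List (Fin 4 × ℤ × ℤ)) := by
  obtain ⟨⟨hi₁, hi₂⟩, hj₁, hj₂⟩ := centre_bounds one_pos one_pos P.h0 Q.h0
  match k, Q, hi₁, hi₂, hj₁, hj₂ with
  | 0, Q, hi₁, hi₂, hj₁, hj₂ =>
    change InOpenCell 1 1 (y + i) (x + 1 / 2 + j) s t at Q
    simp only [orbitPoint] at hi₁ hi₂ hj₁ hj₂
    obtain ⟨hil, hiu⟩ := int_mem_Ioo_of_cast (i := i) (a := -2) (b := 1)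
      (by push_cast; linarith) (by push_cast; linarith)
    obtain ⟨hjl, hju⟩ := int_mem_Ioo_of_cast (i := j) (a := -2) (b := 1)
      (by push_cast; linarith) (by push_cast; linarith)
    clear hi₁ hi₂ hj₁ hj₂
    interval_cases i <;> interval_cases j
    · exfalso
      have h := HalfPlane.combine (1 / 2 - y - x) (2 * x) (1 - 2 * y)
        (P.h0 (-1) (-1) (by decide)) (P.h2 (-1) 0) (Q.h2 0 (-1))
        (by linarith) (by linarith) (by linarith) (by linarith)
      push_cast at h
      have k : 0 ≤ 1 / 2 * x := by linarith
      linarith only [h, k]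
    · exfalso
      have h := HalfPlane.combine (1) (1 / 2 - 2 * y) (1 / 2)
        (P.h2 (-1) 0) (Q.h0 0 (-1) (by decide)) (Q.h0 1 0 (by decide))
        (by linarith) (by linarith) (by linarith) (by linarith)
      push_cast at h
      have k : 0 ≤ x - 2 * x * y := by nlinarith
      linarith only [h, k]
    · decide
    · decide
  | 1, Q, hi₁, hi₂, hj₁, hj₂ =>
    change InOpenCell 1 1 (-y + i) (-(x + 1 / 2) + j) s t at Q
    simp only [orbitPoint] at hi₁ hi₂ hj₁ hj₂
    obtain ⟨hil, hiu⟩ := int_mem_Ioo_of_cast (i := i) (a := -1) (b := 2)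
      (by push_cast; linarith) (by push_cast; linarith)
    obtain ⟨hjl, hju⟩ := int_mem_Ioo_of_cast (i := j) (a := -1) (b := 2)
      (by push_cast; linarith) (by push_cast; linarith)
    clear hi₁ hi₂ hj₁ hj₂
    interval_cases i <;> interval_cases j
    · exfalso
      have h := HalfPlane.combine (1 / 2) (y + 4 * y ^ 2 - x) (y - 4 * y ^ 2 + x)
        (P.h1 0 0) (Q.h3 (-1) 0) (Q.h3 0 0)
        (by linarith) (by nlinarith) (by nlinarith) (by linarith)
      push_cast at h
      have k : 0 ≤ 4 * y ^ 3 := by nlinarith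
      linarith only [h, k]
    · decide
    · exfalso
      have h := HalfPlane.combine (2 * y) (y - x) (2 * x)
        (P.h3 0 (-1)) (Q.h0 (-1) 1 (by decide)) (Q.h3 1 0)
        (by linarith) (by linarith) (by linarith) (by linarith)
      push_cast at h
      have k : 0 ≤ 1 / 2 * x := by linarith
      linarith only [h, k]
    · exfalso
      have h := HalfPlane.combine (2 * x - 4 * x ^ 2) (y - x) (y + x - 4 * x * y)
        (P.h2 0 0) (P.h3 0 0) (Q.h2 (-1) 0)
        (by nlinarith) (by linarith) (by nlinarith) (by nlinarith)
      push_cast at h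
      have k : 0 ≤ 1 / 4 * y - y ^ 2 + 1 / 4 * x - x * y + 2 * x * y ^ 2 - x ^ 2 + 2 * x ^ 3 := by nlinarith
      linarith only [h, k]
  | 2, Q, hi₁, hi₂, hj₁, hj₂ =>
    change InOpenCell 1 1 (1 / 2 + y + i) (1 / 2 - (x + 1 / 2) + j) s t at Q
    simp only [orbitPoint] at hi₁ hi₂ hj₁ hj₂
    obtain ⟨hil, hiu⟩ := int_mem_Ioo_of_cast (i := i) (a := -2) (b := 1)
      (by push_cast; linarith) (by push_cast; linarith)
    obtain ⟨hjl, hju⟩ := int_mem_Ioo_of_cast (i := j) (a := -1) (b := 2)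
      (by push_cast; linarith) (by push_cast; linarith)
    clear hi₁ hi₂ hj₁ hj₂
    interval_cases i <;> interval_cases j
    · decide
    · decide
    · exfalso
      have h := HalfPlane.combine (y - x + 4 * x ^ 2) (y - 4 * y ^ 2 + x) (1 / 2 - y - x + 4 * x * y)
        (P.h2 0 0) (P.h3 0 (-1)) (Q.h1 1 0)
        (by nlinarith) (by nlinarith) (by nlinarith) (by nlinarith)
      push_cast at h
      have k : 0 ≤ y ^ 2 - 2 * y ^ 3 - x * y + 2 * x * y ^ 2 + 2 * x ^ 2 * y - 2 * x ^ 3 := by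
          nlinarith only [mul_nonneg (sub_nonneg.2 hxy) (by nlinarith : 0 ≤ y * (1 - 2 * y) + 2 * x ^ 2)]
      linarith only [h, k]
    · exfalso
      have h := HalfPlane.combine (y - x) (2 * x) (2 * y)
        (P.h0 1 1 (by decide)) (P.h2 0 0) (Q.h2 (-1) 1)
        (by linarith) (by linarith) (by linarith) (by linarith)
      push_cast at h
      have k : 0 ≤ 1 / 2 * x - 2 * x * y := by nlinarith
      linarith only [h, k]
  | 3, Q, hi₁, hi₂, hj₁, hj₂ =>
    change InOpenCell 1 1 (1 / 2 - y + i) (1 / 2 + (x + 1 / 2) + j) s t at Q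
    simp only [orbitPoint] at hi₁ hi₂ hj₁ hj₂
    obtain ⟨hil, hiu⟩ := int_mem_Ioo_of_cast (i := i) (a := -2) (b := 1)
      (by push_cast; linarith) (by push_cast; linarith)
    obtain ⟨hjl, hju⟩ := int_mem_Ioo_of_cast (i := j) (a := -2) (b := 1)
      (by push_cast; linarith) (by push_cast; linarith)
    clear hi₁ hi₂ hj₁ hj₂
    interval_cases i <;> interval_cases j
    · decide
    · exfalso
      have h := HalfPlane.combine (1) (1 - 2 * y) (2 * x)
        (P.h1 0 1) (Q.h0 0 (-1) (by decide)) (Q.h0 1 0 (by decide))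
        (by linarith) (by linarith) (by linarith) (by linarith)
      push_cast at h
      have k : 0 ≤ x := by linarith
      linarith only [h, k]
    · decide
    · exfalso
      have h := HalfPlane.combine (1 / 2) (1 / 2 - 2 * y) (1)
        (P.h0 0 1 (by decide)) (P.h0 1 0 (by decide)) (Q.h3 0 (-1))
        (by linarith) (by linarith) (by linarith) (by linarith)
      push_cast at h
      have k : 0 ≤ 2 * x * y := by nlinarith
      linarith only [h, k]

theorem mem_of_inOpenCell_swap_shift_both {x y s t : ℝ}
    (hx₀ : 0 ≤ x) (hxy : x ≤ y) (hy₀ : 0 < y) (hy : y ≤ 1 / 4)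
    (P : InOpenCell 1 1 x y s t) {k : Fin 4} {i j : ℤ}
    (Q : InOpenCell 1 1 (orbitPoint (y + 1 / 2, x + 1 / 2) (k, i, j)).1 (orbitPoint (y + 1 / 2, x + 1 / 2) (k, i, j)).2 s t) :
    (k, i, j) ∈ ([(0, -1, 0), (0, 0, -1), (1, 1, 1), (2, -1, 0), (2, -1, 1), (3, 0, -1), (3, 1, -1)] : List (Fin 4 × ℤ × ℤ)) := by
  obtain ⟨⟨hi₁, hi₂⟩, hj₁, hj₂⟩ := centre_bounds one_pos one_pos P.h0 Q.h0
  match k, Q, hi₁, hi₂, hj₁, hj₂ with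
  | 0, Q, hi₁, hi₂, hj₁, hj₂ =>
    change InOpenCell 1 1 (y + 1 / 2 + i) (x + 1 / 2 + j) s t at Q
    simp only [orbitPoint] at hi₁ hi₂ hj₁ hj₂
    obtain ⟨hil, hiu⟩ := int_mem_Ioo_of_cast (i := i) (a := -2) (b := 1)
      (by push_cast; linarith) (by push_cast; linarith)
    obtain ⟨hjl, hju⟩ := int_mem_Ioo_of_cast (i := j) (a := -2) (b := 1)
      (by push_cast; linarith) (by push_cast; linarith)
    clear hi₁ hi₂ hj₁ hj₂
    interval_cases i <;> interval_cases j
    · exfalso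
      have h := HalfPlane.combine (1 / 2 - y - x) (y - x + 4 * x ^ 2) (y + x - 4 * x * y)
        (P.h1 0 0) (P.h2 (-1) 0) (Q.h2 0 (-1))
        (by linarith) (by nlinarith) (by nlinarith) (by nlinarith)
      push_cast at h
      -- This is `2x(1/2 - x - y)²`.
      have k : 0 ≤ 1 / 2 * x - 2 * x * y + 2 * x * y ^ 2 - 2 * x ^ 2 + 4 * x ^ 2 * y + 2 * x ^ 3 := by
          nlinarith only [mul_nonneg hx₀ (sq_nonneg (1 / 2 - x - y))]
      linarith only [h, k]
    · decide
    · decide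
    · exfalso
      have h := HalfPlane.combine (y + x - 4 * x * y) (1 / 2 - y - x) (y - x + 4 * x ^ 2)
        (P.h3 0 0) (Q.h1 1 1) (Q.h3 1 (-1))
        (by nlinarith) (by linarith) (by nlinarith) (by nlinarith)
      push_cast at h
      have k : 0 ≤ 1 / 2 * x - 2 * x * y + 2 * x * y ^ 2 - 2 * x ^ 2 + 4 * x ^ 2 * y + 2 * x ^ 3 := by
          nlinarith only [mul_nonneg hx₀ (sq_nonneg (1 / 2 - x - y))]
      linarith only [h, k]
  | 1, Q, hi₁, hi₂, hj₁, hj₂ =>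
    change InOpenCell 1 1 (-(y + 1 / 2) + i) (-(x + 1 / 2) + j) s t at Q
    simp only [orbitPoint] at hi₁ hi₂ hj₁ hj₂
    obtain ⟨hil, hiu⟩ := int_mem_Ioo_of_cast (i := i) (a := -1) (b := 2)
      (by push_cast; linarith) (by push_cast; linarith)
    obtain ⟨hjl, hju⟩ := int_mem_Ioo_of_cast (i := j) (a := -1) (b := 2)
      (by push_cast; linarith) (by push_cast; linarith)
    clear hi₁ hi₂ hj₁ hj₂
    interval_cases i <;> interval_cases j
    · exfalso
      have h := HalfPlane.combine (1) (2 * y) (2 * x)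
        (P.h1 0 0) (Q.h0 0 1 (by decide)) (Q.h0 1 0 (by decide))
        (by linarith) (by linarith) (by linarith) (by linarith)
      push_cast at h
      have k : 0 ≤ 4 * x * y := by nlinarith
      linarith only [h, k]
    · exfalso
      have h := HalfPlane.combine (1 / 2) (1 / 2 - y + x) (y - x)
        (P.h2 (-1) 0) (Q.h2 0 0) (Q.h2 0 1)
        (by linarith) (by linarith) (by linarith) (by linarith)
      push_cast at h
      have k : 0 ≤ 1 / 2 * x - x * y + x ^ 2 := by nlinarith
      linarith only [h, k]
    · exfalso
      have h := HalfPlane.combine (y - x) (1 / 2 - y + x) (1 / 2)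
        (P.h3 (-1) (-1)) (P.h3 0 (-1)) (Q.h3 0 0)
        (by linarith) (by linarith) (by linarith) (by linarith)
      push_cast at h
      have k : 0 ≤ 1 / 2 * x - x * y + x ^ 2 := by nlinarith
      linarith only [h, k]
    · decide
  | 2, Q, hi₁, hi₂, hj₁, hj₂ =>
    change InOpenCell 1 1 (1 / 2 + (y + 1 / 2) + i) (1 / 2 - (x + 1 / 2) + j) s t at Q
    simp only [orbitPoint] at hi₁ hi₂ hj₁ hj₂
    obtain ⟨hil, hiu⟩ := int_mem_Ioo_of_cast (i := i) (a := -3) (b := 0)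
      (by push_cast; linarith) (by push_cast; linarith)
    obtain ⟨hjl, hju⟩ := int_mem_Ioo_of_cast (i := j) (a := -1) (b := 2)
      (by push_cast; linarith) (by push_cast; linarith)
    clear hi₁ hi₂ hj₁ hj₂
    interval_cases i <;> interval_cases j
    · exfalso
      have h := HalfPlane.combine (1 - 2 * y) (2 * x) (1)
        (P.h0 (-1) 0 (by decide)) (P.h0 0 (-1) (by decide)) (Q.h1 (-1) 0)
        (by linarith) (by linarith) (by linarith) (by linarith)
      push_cast at h
      linarith only [h]
    · exfalso
      have h := HalfPlane.combine (1) (1 - 2 * y) (2 * x)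
        (P.h1 0 1) (Q.h0 0 (-1) (by decide)) (Q.h0 1 0 (by decide))
        (by linarith) (by linarith) (by linarith) (by linarith)
      push_cast at h
      linarith only [h]
    · decide
    · decide
  | 3, Q, hi₁, hi₂, hj₁, hj₂ =>
    change InOpenCell 1 1 (1 / 2 - (y + 1 / 2) + i) (1 / 2 + (x + 1 / 2) + j) s t at Q
    simp only [orbitPoint] at hi₁ hi₂ hj₁ hj₂
    obtain ⟨hil, hiu⟩ := int_mem_Ioo_of_cast (i := i) (a := -1) (b := 2)
      (by push_cast; linarith) (by push_cast; linarith)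
    obtain ⟨hjl, hju⟩ := int_mem_Ioo_of_cast (i := j) (a := -2) (b := 1)
      (by push_cast; linarith) (by push_cast; linarith)
    clear hi₁ hi₂ hj₁ hj₂
    interval_cases i <;> interval_cases j
    · decide
    · exfalso
      have h := HalfPlane.combine (1) (1 - 2 * y) (2 * x)
        (P.h1 0 1) (Q.h0 0 (-1) (by decide)) (Q.h0 1 0 (by decide))
        (by linarith) (by linarith) (by linarith) (by linarith)
      push_cast at h
      linarith only [h]
    · decide
    · exfalso
      have h := HalfPlane.combine (1 / 2) (1 / 2 - 2 * y) (1)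
        (P.h0 0 1 (by decide)) (P.h0 1 0 (by decide)) (Q.h3 1 (-1))
        (by linarith) (by linarith) (by linarith) (by linarith)
      push_cast at h
      have k : 0 ≤ 1 / 4 - y + 2 * x * y := by nlinarith
      linarith only [h, k]

/-! ### Orbits and near points in coordinates -/

/-- The squared distance in coordinates with respect to perpendicular vectors of squared
lengths `α` and `β`. -/
def coordDist (α β : ℝ) (p z : ℝ × ℝ) : ℝ :=
  α * (z.1 - p.1) ^ 2 + β * (z.2 - p.2) ^ 2

/-- The `pgg` orbit of a point, in coordinates. -/
def coordOrbit (r : ℝ × ℝ) : Set (ℝ × ℝ) :=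
  Set.range (orbitPoint r)

/-- `z` is strictly closer to `p` than to all other points of `S`. -/
def IsStrictlyNearest (α β : ℝ) (S : Set (ℝ × ℝ)) (p z : ℝ × ℝ) : Prop :=
  ∀ s ∈ S, s ≠ p → coordDist α β p z < coordDist α β s z

/-- The points in the orbit of `r` whose open Dirichlet cells meet the open Dirichlet cell of `p`
in its own orbit. -/
def nearPoints (α β : ℝ) (p r : ℝ × ℝ) : Set (ℝ × ℝ) :=
  {q | q ∈ coordOrbit r ∧ ∃ z, IsStrictlyNearest α β (coordOrbit p) p z ∧
    IsStrictlyNearest α β (coordOrbit r) q z}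

/-- A centre of a half-turn, in coordinates. -/
def IsHalfLattice (r : ℝ × ℝ) : Prop :=
  ∃ m n : ℤ, 2 * r.1 = m ∧ 2 * r.2 = n

theorem self_mem_coordOrbit (r : ℝ × ℝ) : r ∈ coordOrbit r :=
  ⟨(0, 0, 0), by simp [orbitPoint]⟩

/-- The multiplication table of the group modulo its translations, with the integer corrections that
each product needs. -/
theorem exists_orbitPoint_comp (t t' : Fin 4 × ℤ × ℤ) :
    ∃ t'', ∀ r, orbitPoint (orbitPoint r t) t' = orbitPoint r t'' := by
  obtain ⟨k, i, j⟩ := t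
  obtain ⟨l, m, n⟩ := t'
  match k, l with
  | 0, 0 => exact ⟨(0, i + m, j + n), fun r => by
      ext <;> simp only [orbitPoint] <;> push_cast <;> ring⟩
  | 0, 1 => exact ⟨(1, -i + m, -j + n), fun r => by
      ext <;> simp only [orbitPoint] <;> push_cast <;> ring⟩
  | 0, 2 => exact ⟨(2, i + m, -j + n), fun r => by
      ext <;> simp only [orbitPoint] <;> push_cast <;> ring⟩
  | 0, 3 => exact ⟨(3, -i + m, j + n), fun r => by
      ext <;> simp only [orbitPoint] <;> push_cast <;> ring⟩
  | 1, 0 => exact ⟨(1, i + m, j + n), fun r => by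
      ext <;> simp only [orbitPoint] <;> push_cast <;> ring⟩
  | 1, 1 => exact ⟨(0, -i + m, -j + n), fun r => by
      ext <;> simp only [orbitPoint] <;> push_cast <;> ring⟩
  | 1, 2 => exact ⟨(3, i + m, -j + n), fun r => by
      ext <;> simp only [orbitPoint] <;> push_cast <;> ring⟩
  | 1, 3 => exact ⟨(2, -i + m, j + n), fun r => by
      ext <;> simp only [orbitPoint] <;> push_cast <;> ring⟩
  | 2, 0 => exact ⟨(2, i + m, j + n), fun r => by
      ext <;> simp only [orbitPoint] <;> push_cast <;> ring⟩
  | 2, 1 => exact ⟨(3, -1 - i + m, -1 - j + n), fun r => by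
      ext <;> simp only [orbitPoint] <;> push_cast <;> ring⟩
  | 2, 2 => exact ⟨(0, 1 + i + m, -j + n), fun r => by
      ext <;> simp only [orbitPoint] <;> push_cast <;> ring⟩
  | 2, 3 => exact ⟨(1, -i + m, 1 + j + n), fun r => by
      ext <;> simp only [orbitPoint] <;> push_cast <;> ring⟩
  | 3, 0 => exact ⟨(3, i + m, j + n), fun r => by
      ext <;> simp only [orbitPoint] <;> push_cast <;> ring⟩
  | 3, 1 => exact ⟨(2, -1 - i + m, -1 - j + n), fun r => by
      ext <;> simp only [orbitPoint] <;> push_cast <;> ring⟩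
  | 3, 2 => exact ⟨(1, 1 + i + m, -j + n), fun r => by
      ext <;> simp only [orbitPoint] <;> push_cast <;> ring⟩
  | 3, 3 => exact ⟨(0, -i + m, 1 + j + n), fun r => by
      ext <;> simp only [orbitPoint] <;> push_cast <;> ring⟩

theorem exists_orbitPoint_inv (t : Fin 4 × ℤ × ℤ) :
    ∃ t', ∀ r, orbitPoint (orbitPoint r t) t' = r := by
  obtain ⟨k, i, j⟩ := t
  match k with
  | 0 => exact ⟨(0, -i, -j), fun r => by ext <;> simp only [orbitPoint] <;> push_cast <;> ring⟩
  | 1 => exact ⟨(1, i, j), fun r => by ext <;> simp only [orbitPoint] <;> ring⟩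
  | 2 => exact ⟨(2, -1 - i, j), fun r => by ext <;> simp only [orbitPoint] <;> push_cast <;> ring⟩
  | 3 => exact ⟨(3, i, -1 - j), fun r => by ext <;> simp only [orbitPoint] <;> push_cast <;> ring⟩

theorem coordOrbit_subset {q r : ℝ × ℝ} (h : q ∈ coordOrbit r) : coordOrbit q ⊆ coordOrbit r := by
  obtain ⟨t, rfl⟩ := h
  rintro _ ⟨t', rfl⟩
  obtain ⟨t'', h⟩ := exists_orbitPoint_comp t t'
  exact ⟨t'', (h r).symm⟩

theorem mem_coordOrbit_symm {q r : ℝ × ℝ} (h : q ∈ coordOrbit r) : r ∈ coordOrbit q := by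
  obtain ⟨t, rfl⟩ := h
  obtain ⟨t', h⟩ := exists_orbitPoint_inv t
  exact ⟨t', h r⟩

theorem coordOrbit_eq {q r : ℝ × ℝ} (h : q ∈ coordOrbit r) : coordOrbit q = coordOrbit r :=
  (coordOrbit_subset h).antisymm (coordOrbit_subset (mem_coordOrbit_symm h))

theorem IsHalfLattice.of_orbitPoint {r : ℝ × ℝ} {t : Fin 4 × ℤ × ℤ}
    (h : IsHalfLattice (orbitPoint r t)) : IsHalfLattice r := by
  obtain ⟨k, i, j⟩ := t
  obtain ⟨m, n, hm, hn⟩ := h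
  match k with
  | 0 =>
    simp only [orbitPoint] at hm hn
    exact ⟨m - 2 * i, n - 2 * j, by push_cast; linarith, by push_cast; linarith⟩
  | 1 =>
    simp only [orbitPoint] at hm hn
    exact ⟨2 * i - m, 2 * j - n, by push_cast; linarith, by push_cast; linarith⟩
  | 2 =>
    simp only [orbitPoint] at hm hn
    exact ⟨m - 2 * i - 1, 1 + 2 * j - n, by push_cast; linarith, by push_cast; linarith⟩
  | 3 =>
    simp only [orbitPoint] at hm hn
    exact ⟨1 + 2 * i - m, n - 2 * j - 1, by push_cast; linarith, by push_cast; linarith⟩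

theorem halfPlane_of_coordDist_lt {α β d e : ℝ} {p s z : ℝ × ℝ}
    (h : coordDist α β p z < coordDist α β s z) (hd : s.1 - p.1 = d) (he : s.2 - p.2 = e) :
    HalfPlane α β d e (z.1 - p.1) (z.2 - p.2) := by
  subst hd he
  unfold coordDist at h
  unfold HalfPlane
  linarith

theorem IsStrictlyNearest.translates {α β : ℝ} {p z : ℝ × ℝ}
    (h : IsStrictlyNearest α β (coordOrbit p) p z) (i j : ℤ) (hij : (i, j) ≠ (0, 0)) :
    HalfPlane α β i j (z.1 - p.1) (z.2 - p.2) := by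
  refine halfPlane_of_coordDist_lt (h _ ⟨(0, i, j), rfl⟩ fun hp => hij ?_) ?_ ?_
  · rw [Prod.ext_iff] at hp ⊢
    simpa [orbitPoint] using hp
  · simp [orbitPoint]
  · simp [orbitPoint]

theorem half_add_intCast_ne_zero (i : ℤ) : (1 / 2 : ℝ) + i ≠ 0 := by
  intro h
  have h' : ((1 + 2 * i : ℤ) : ℝ) = 0 := by push_cast; linarith
  have : 1 + 2 * i = 0 := by exact_mod_cast h'
  omega

/-- A half-turn of the group fixes `p` exactly when `p` is in the half-lattice; its inequality in
`h1` would then read `0 < 0`. Glide reflections fix no point, since they move one coordinate by an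
element of `1/2 + ℤ` independent of `p`. -/
theorem IsStrictlyNearest.inOpenCell {α β : ℝ} {p z : ℝ × ℝ} (hp : ¬ IsHalfLattice p)
    (h : IsStrictlyNearest α β (coordOrbit p) p z) : InOpenCell α β p.1 p.2 z.1 z.2 := by
  refine ⟨h.translates, fun i j => ?_, fun i j => ?_, fun i j => ?_⟩
  · refine halfPlane_of_coordDist_lt (h _ ⟨(1, i, j), rfl⟩ fun he => hp ⟨i, j, ?_, ?_⟩) ?_ ?_
    · have := congrArg Prod.fst he
      simp only [orbitPoint] at this
      linarith
    · have := congrArg Prod.snd he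
      simp only [orbitPoint] at this
      linarith
    all_goals
      simp only [orbitPoint]
      ring
  · refine halfPlane_of_coordDist_lt
      (h _ ⟨(2, i, j), rfl⟩ fun he => half_add_intCast_ne_zero i ?_) ?_ ?_
    · have := congrArg Prod.fst he
      simp only [orbitPoint] at this
      linarith
    all_goals
      simp only [orbitPoint]
      ring
  · refine halfPlane_of_coordDist_lt
      (h _ ⟨(3, i, j), rfl⟩ fun he => half_add_intCast_ne_zero j ?_) ?_ ?_
    · have := congrArg Prod.snd he
      simp only [orbitPoint] at this
      linarith
    all_goals
      simp only [orbitPoint]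
      ring

theorem HalfPlane.of_eq_weights {α d e a b : ℝ} (hα : 0 < α) (h : HalfPlane α α d e a b) :
    HalfPlane 1 1 d e a b := by
  unfold HalfPlane at h ⊢
  refine lt_of_mul_lt_mul_left ?_ hα.le
  linarith

theorem InOpenCell.of_eq_weights {α x y s t : ℝ} (hα : 0 < α) (h : InOpenCell α α x y s t) :
    InOpenCell 1 1 x y s t :=
  ⟨fun i j hij => (h.h0 i j hij).of_eq_weights hα, fun i j => (h.h1 i j).of_eq_weights hα,
    fun i j => (h.h2 i j).of_eq_weights hα, fun i j => (h.h3 i j).of_eq_weights hα⟩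

theorem encard_le_seven_of_list {γ : Type*} {S : Set γ} (l : List γ) (hl : l.length ≤ 7)
    (h : ∀ q ∈ S, q ∈ l) : S.encard ≤ 7 := by
  classical
  calc S.encard ≤ ((l.toFinset : Finset γ) : Set γ).encard :=
        Set.encard_le_encard fun q hq => by simpa using h q hq
    _ = l.toFinset.card := Set.encard_coe_eq_coe_finsetCard _
    _ ≤ 7 := by exact_mod_cast (List.toFinset_card_le l).trans hl

/-- Passes from indices to points: a near point is also a centre of its own orbit, which is the
orbit of `r`, so its cell can be described from its own coordinates. -/
theorem encard_nearPoints_le_of_list {α β : ℝ} {p r : ℝ × ℝ} (l : List (Fin 4 × ℤ × ℤ))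
    (hl : l.length ≤ 7) (hp : ¬ IsHalfLattice p) (hr : ¬ IsHalfLattice r)
    (h : ∀ (k : Fin 4) (i j : ℤ) (s t : ℝ), InOpenCell α β p.1 p.2 s t →
      InOpenCell α β (orbitPoint r (k, i, j)).1 (orbitPoint r (k, i, j)).2 s t → (k, i, j) ∈ l) :
    (nearPoints α β p r).encard ≤ 7 := by
  refine encard_le_seven_of_list (l.map (orbitPoint r)) (by simpa using hl) ?_
  rintro _ ⟨⟨⟨k, i, j⟩, rfl⟩, z, hz, hz'⟩
  refine List.mem_map_of_mem (h k i j z.1 z.2 (hz.inOpenCell hp) ?_)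
  refine IsStrictlyNearest.inOpenCell (fun hq => hr hq.of_orbitPoint) ?_
  rwa [coordOrbit_eq ⟨_, rfl⟩]

theorem encard_nearPoints_self_le (α β : ℝ) (p : ℝ × ℝ) : (nearPoints α β p p).encard ≤ 7 := by
  refine encard_le_seven_of_list [p] (by simp) ?_
  rintro q ⟨hq, z, hz, hz'⟩
  by_contra hne
  have hne : q ≠ p := by simpa using hne
  exact lt_asymm (hz q hq hne) (hz' p (self_mem_coordOrbit p) hne.symm)

theorem nearPoints_congr (α β : ℝ) (p : ℝ × ℝ) {q r : ℝ × ℝ} (h : q ∈ coordOrbit r) :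
    nearPoints α β p q = nearPoints α β p r := by
  unfold nearPoints
  rw [coordOrbit_eq h]

/-- The case of an orbit of half-turn centres. -/
theorem encard_nearPoints_zero_le {α β : ℝ} (hα : 0 < α) (hβ : 0 < β) :
    (nearPoints α β (0, 0) (1 / 2, 0)).encard ≤ 7 := by
  refine encard_le_seven_of_list [(1 / 2, 0), (-(1 / 2), 0), (0, 1 / 2), (0, -(1 / 2))]
    (by simp) ?_
  rintro _ ⟨⟨⟨k, i, j⟩, rfl⟩, z, hz, hz'⟩
  rw [← coordOrbit_eq ⟨_, rfl⟩] at hz'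
  obtain ⟨⟨hi₁, hi₂⟩, hj₁, hj₂⟩ := centre_bounds hα hβ hz.translates hz'.translates
  match k, hi₁, hi₂, hj₁, hj₂ with
  | 0, hi₁, hi₂, hj₁, hj₂ =>
    simp only [orbitPoint] at hi₁ hi₂ hj₁ hj₂
    obtain ⟨hil, hiu⟩ := int_mem_Ioo_of_cast (i := i) (a := -2) (b := 1)
      (by push_cast; linarith) (by push_cast; linarith)
    obtain ⟨hjl, hju⟩ := int_mem_Ioo_of_cast (i := j) (a := -1) (b := 1)
      (by push_cast; linarith) (by push_cast; linarith)
    clear hi₁ hi₂ hj₁ hj₂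
    interval_cases i <;> interval_cases j <;> norm_num [orbitPoint]
  | 1, hi₁, hi₂, hj₁, hj₂ =>
    simp only [orbitPoint] at hi₁ hi₂ hj₁ hj₂
    obtain ⟨hil, hiu⟩ := int_mem_Ioo_of_cast (i := i) (a := -1) (b := 2)
      (by push_cast; linarith) (by push_cast; linarith)
    obtain ⟨hjl, hju⟩ := int_mem_Ioo_of_cast (i := j) (a := -1) (b := 1)
      (by push_cast; linarith) (by push_cast; linarith)
    clear hi₁ hi₂ hj₁ hj₂
    interval_cases i <;> interval_cases j <;> norm_num [orbitPoint]
  | 2, hi₁, hi₂, hj₁, hj₂ =>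
    simp only [orbitPoint] at hi₁ hi₂ hj₁ hj₂
    obtain ⟨hil, hiu⟩ := int_mem_Ioo_of_cast (i := i) (a := -2) (b := 0)
      (by push_cast; linarith) (by push_cast; linarith)
    obtain ⟨hjl, hju⟩ := int_mem_Ioo_of_cast (i := j) (a := -2) (b := 1)
      (by push_cast; linarith) (by push_cast; linarith)
    clear hi₁ hi₂ hj₁ hj₂
    (interval_cases i; interval_cases j) <;> norm_num [orbitPoint]
  | 3, hi₁, hi₂, hj₁, hj₂ =>
    simp only [orbitPoint] at hi₁ hi₂ hj₁ hj₂
    obtain ⟨hil, hiu⟩ := int_mem_Ioo_of_cast (i := i) (a := -1) (b := 1)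
      (by push_cast; linarith) (by push_cast; linarith)
    obtain ⟨hjl, hju⟩ := int_mem_Ioo_of_cast (i := j) (a := -2) (b := 1)
      (by push_cast; linarith) (by push_cast; linarith)
    clear hi₁ hi₂ hj₁ hj₂
    (interval_cases i; interval_cases j) <;> norm_num [orbitPoint]

/-! ### Symmetries of the coordinate picture -/

/-- A bijection carrying `pgg` orbits to `pgg` orbits and the quadratic form to another one
preserves the number of near points. -/
theorem encard_nearPoints_symm {α β α' β' : ℝ} (σ : ℝ × ℝ ≃ ℝ × ℝ)
    (h : ∀ r, ∀ q ∈ coordOrbit r, σ q ∈ coordOrbit (σ r))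
    (h' : ∀ r, ∀ q ∈ coordOrbit r, σ.symm q ∈ coordOrbit (σ.symm r))
    (hd : ∀ p z, coordDist α' β' (σ p) (σ z) = coordDist α β p z) (p r : ℝ × ℝ) :
    (nearPoints α' β' (σ p) (σ r)).encard = (nearPoints α β p r).encard := by
  have hiff : ∀ q r, σ q ∈ coordOrbit (σ r) ↔ q ∈ coordOrbit r := fun q r =>
    ⟨fun hq => by simpa using h' _ _ hq, h r q⟩
  have hnear : ∀ r q z, IsStrictlyNearest α' β' (coordOrbit (σ r)) (σ q) (σ z) ↔
      IsStrictlyNearest α β (coordOrbit r) q z := by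
    intro r q z
    constructor
    · intro H s hs hne
      have := H (σ s) (h r s hs) (σ.injective.ne hne)
      rwa [hd, hd] at this
    · intro H s hs hne
      obtain ⟨s, rfl⟩ := σ.surjective s
      rw [hd, hd]
      exact H s ((hiff s r).1 hs) fun he => hne (he ▸ rfl)
  have himage : nearPoints α' β' (σ p) (σ r) = σ '' nearPoints α β p r := by
    ext q
    obtain ⟨q, rfl⟩ := σ.surjective q
    rw [σ.injective.mem_set_image]
    constructor
    · rintro ⟨hq, z, hz, hz'⟩
      obtain ⟨z, rfl⟩ := σ.surjective z
      exact ⟨(hiff q r).1 hq, z, (hnear p p z).1 hz, (hnear r q z).1 hz'⟩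
    · rintro ⟨hq, z, hz, hz'⟩
      exact ⟨h r q hq, σ z, (hnear p p z).2 hz, (hnear r q z).2 hz'⟩
  rw [himage, σ.injective.encard_image]

theorem swap_mem_coordOrbit (r q : ℝ × ℝ) (h : q ∈ coordOrbit r) :
    q.swap ∈ coordOrbit r.swap := by
  obtain ⟨⟨k, i, j⟩, rfl⟩ := h
  match k with
  | 0 => exact ⟨(0, j, i), rfl⟩
  | 1 => exact ⟨(1, j, i), rfl⟩
  | 2 => exact ⟨(3, j, i), rfl⟩
  | 3 => exact ⟨(2, j, i), rfl⟩

theorem encard_nearPoints_swap (α β : ℝ) (p r : ℝ × ℝ) :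
    (nearPoints β α p.swap r.swap).encard = (nearPoints α β p r).encard :=
  encard_nearPoints_symm (Equiv.prodComm ℝ ℝ) swap_mem_coordOrbit swap_mem_coordOrbit
    (fun p z => by simp only [coordDist, Equiv.prodComm_apply, Prod.fst_swap, Prod.snd_swap]; ring)
    p r

theorem shift_mem_coordOrbit (m n : ℤ) (r q : ℝ × ℝ) (h : q ∈ coordOrbit r) :
    q + ((m : ℝ) / 2, (n : ℝ) / 2) ∈ coordOrbit (r + ((m : ℝ) / 2, (n : ℝ) / 2)) := by
  obtain ⟨⟨k, i, j⟩, rfl⟩ := h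
  match k with
  | 0 => exact ⟨(0, i, j), by ext <;> simp only [orbitPoint, Prod.fst_add, Prod.snd_add] <;> ring⟩
  | 1 => exact ⟨(1, i + m, j + n), by
      ext <;> simp only [orbitPoint, Prod.fst_add, Prod.snd_add] <;> push_cast <;> ring⟩
  | 2 => exact ⟨(2, i, j + n), by
      ext <;> simp only [orbitPoint, Prod.fst_add, Prod.snd_add] <;> push_cast <;> ring⟩
  | 3 => exact ⟨(3, i + m, j), by
      ext <;> simp only [orbitPoint, Prod.fst_add, Prod.snd_add] <;> push_cast <;> ring⟩

theorem encard_nearPoints_shift (α β : ℝ) (p r : ℝ × ℝ) (m n : ℤ) :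
    (nearPoints α β (p + ((m : ℝ) / 2, (n : ℝ) / 2))
      (r + ((m : ℝ) / 2, (n : ℝ) / 2))).encard = (nearPoints α β p r).encard := by
  refine encard_nearPoints_symm (Equiv.addRight ((m : ℝ) / 2, (n : ℝ) / 2))
    (shift_mem_coordOrbit m n) (fun r q h => ?_) (fun p z => ?_) p r
  · have := shift_mem_coordOrbit (-m) (-n) r q h
    push_cast at this
    simpa [neg_div] using this
  · simp [coordDist]

/-- The reflection changing the sign of the first coordinate. -/
def negFst : ℝ × ℝ ≃ ℝ × ℝ :=
  (Equiv.neg ℝ).prodCongr (Equiv.refl ℝ)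

theorem negFst_mem_coordOrbit (r q : ℝ × ℝ) (h : q ∈ coordOrbit r) :
    negFst q ∈ coordOrbit (negFst r) := by
  obtain ⟨⟨k, i, j⟩, rfl⟩ := h
  match k with
  | 0 => exact ⟨(0, -i, j), by ext <;> simp [orbitPoint, negFst]; ring⟩
  | 1 => exact ⟨(1, -i, j), by ext <;> simp [orbitPoint, negFst]; ring⟩
  | 2 => exact ⟨(2, -1 - i, j), by ext <;> simp [orbitPoint, negFst]; ring⟩
  | 3 => exact ⟨(3, -1 - i, j), by ext <;> simp [orbitPoint, negFst]; ring⟩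

theorem encard_nearPoints_negFst (α β : ℝ) (p r : ℝ × ℝ) :
    (nearPoints α β (negFst p) (negFst r)).encard = (nearPoints α β p r).encard :=
  encard_nearPoints_symm negFst negFst_mem_coordOrbit negFst_mem_coordOrbit
    (fun p z => by simp only [coordDist, negFst, Equiv.prodCongr_apply, Prod.map_fst, Prod.map_snd,
      Equiv.neg_apply, Equiv.refl_apply]; ring) p r

/-! ### Reduction to the fundamental rectangle -/

/-- The coordinate form of the relation between `p` and its images under the normalizer of a `pgg`
group. -/
def NormalizerRel (α β : ℝ) (p q : ℝ × ℝ) : Prop :=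
  ∃ (ε δ : ℝ) (m n : ℤ), (ε = 1 ∨ ε = -1) ∧ (δ = 1 ∨ δ = -1) ∧
    (q = (ε * p.1 + m / 2, δ * p.2 + n / 2) ∨
      (α = β ∧ q = (ε * p.2 + m / 2, δ * p.1 + n / 2)))

theorem exists_eq_two_mul_add (m : ℤ) : ∃ i a : ℤ, (a = 0 ∨ a = 1) ∧ m = 2 * i + a := by
  rcases Int.even_or_odd' m with ⟨i, h | h⟩
  · exact ⟨i, 0, Or.inl rfl, by omega⟩
  · exact ⟨i, 1, Or.inr rfl, h⟩

/-- Up to the orbit, sign changes and half-lattice translations reduce to four translations. -/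
theorem exists_mem_coordOrbit_shift (x y : ℝ) {ε δ : ℝ} (m n : ℤ) (hε : ε = 1 ∨ ε = -1)
    (hδ : δ = 1 ∨ δ = -1) :
    ∃ a b : ℤ, (a = 0 ∨ a = 1) ∧ (b = 0 ∨ b = 1) ∧
      (ε * x + m / 2, δ * y + n / 2) ∈ coordOrbit (x + a / 2, y + b / 2) := by
  rcases hε with rfl | rfl <;> rcases hδ with rfl | rfl
  · obtain ⟨i, a, ha, rfl⟩ := exists_eq_two_mul_add m
    obtain ⟨j, b, hb, rfl⟩ := exists_eq_two_mul_add n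
    exact ⟨a, b, ha, hb, (0, i, j), by ext <;> simp only [orbitPoint] <;> push_cast <;> ring⟩
  · obtain ⟨i, a, ha, hi⟩ := exists_eq_two_mul_add (m - 1)
    obtain ⟨j, b, hb, hj⟩ := exists_eq_two_mul_add (1 - n)
    obtain rfl : m = 2 * i + a + 1 := by omega
    obtain rfl : n = 1 - (2 * j + b) := by omega
    exact ⟨a, b, ha, hb, (2, i, -j), by ext <;> simp only [orbitPoint] <;> push_cast <;> ring⟩
  · obtain ⟨i, a, ha, hi⟩ := exists_eq_two_mul_add (1 - m)
    obtain ⟨j, b, hb, hj⟩ := exists_eq_two_mul_add (n - 1)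
    obtain rfl : m = 1 - (2 * i + a) := by omega
    obtain rfl : n = 2 * j + b + 1 := by omega
    exact ⟨a, b, ha, hb, (3, -i, j), by ext <;> simp only [orbitPoint] <;> push_cast <;> ring⟩
  · obtain ⟨i, a, ha, hi⟩ := exists_eq_two_mul_add (-m)
    obtain ⟨j, b, hb, hj⟩ := exists_eq_two_mul_add (-n)
    obtain rfl : m = -(2 * i + a) := by omega
    obtain rfl : n = -(2 * j + b) := by omega
    exact ⟨a, b, ha, hb, (1, -i, -j), by ext <;> simp only [orbitPoint] <;> push_cast <;> ring⟩

theorem eq_zero_of_isHalfLattice {x y : ℝ} (hx₀ : 0 ≤ x) (hx : x ≤ 1 / 4) (hy₀ : 0 ≤ y)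
    (hy : y ≤ 1 / 4) (h : IsHalfLattice (x, y)) : x = 0 ∧ y = 0 := by
  obtain ⟨m, n, hm, hn⟩ := h
  simp only at hm hn
  obtain ⟨h₁, h₂⟩ := int_mem_Ioo_of_cast (i := m) (a := -1) (b := 1)
    (by push_cast; linarith) (by push_cast; linarith)
  obtain ⟨h₃, h₄⟩ := int_mem_Ioo_of_cast (i := n) (a := -1) (b := 1)
    (by push_cast; linarith) (by push_cast; linarith)
  obtain rfl : m = 0 := by omega
  obtain rfl : n = 0 := by omega
  push_cast at hm hn
  constructor <;> linarith

theorem IsHalfLattice.of_shift {x y : ℝ} {a b : ℤ}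
    (h : IsHalfLattice (x + a / 2, y + b / 2)) : IsHalfLattice (x, y) := by
  obtain ⟨m, n, hm, hn⟩ := h
  simp only at hm hn
  exact ⟨m - a, n - b, by push_cast; linarith, by push_cast; linarith⟩

theorem IsHalfLattice.swap {r : ℝ × ℝ} (h : IsHalfLattice r) : IsHalfLattice r.swap := by
  obtain ⟨m, n, hm, hn⟩ := h
  exact ⟨n, m, hn, hm⟩

theorem encard_nearPoints_shift_fst_le {α β x y : ℝ} (hα : 0 < α) (hβ : 0 < β) (hx₀ : 0 ≤ x)
    (hx : x ≤ 1 / 4) (hy₀ : 0 ≤ y) (hy : y ≤ 1 / 4) :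
    (nearPoints α β (x, y) (x + 1 / 2, y)).encard ≤ 7 := by
  by_cases hp : IsHalfLattice (x, y)
  · obtain ⟨rfl, rfl⟩ := eq_zero_of_isHalfLattice hx₀ hx hy₀ hy hp
    rw [zero_add]
    exact encard_nearPoints_zero_le hα hβ
  · refine encard_nearPoints_le_of_list _ ?_ hp (fun h => hp ?_) fun k i j s t P Q =>
      mem_of_inOpenCell_shift_fst hα hβ hx₀ hx hy₀ hy P Q
    · simp
    · exact IsHalfLattice.of_shift (a := 1) (b := 0) (by simpa using h)

theorem encard_nearPoints_shift_both_le {α β x y : ℝ} (hα : 0 < α) (hβ : 0 < β) (hx₀ : 0 ≤ x)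
    (hx : x ≤ 1 / 4) (hy₀ : 0 ≤ y) (hy : y ≤ 1 / 4) :
    (nearPoints α β (x, y) (x + 1 / 2, y + 1 / 2)).encard ≤ 7 := by
  by_cases hp : IsHalfLattice (x, y)
  · obtain ⟨rfl, rfl⟩ := eq_zero_of_isHalfLattice hx₀ hx hy₀ hy hp
    -- The glide reflection sends `(0, 0)` to `(1/2, 1/2)`, so the two orbits coincide.
    rw [zero_add, nearPoints_congr α β (0, 0) (r := (0, 0)) ⟨(2, 0, 0), by simp [orbitPoint]⟩]
    exact encard_nearPoints_self_le α β _
  · refine encard_nearPoints_le_of_list _ ?_ hp (fun h => hp ?_) fun k i j s t P Q =>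
      mem_of_inOpenCell_shift_both hα hβ hx₀ hx hy₀ hy P Q
    · simp
    · exact IsHalfLattice.of_shift (a := 1) (b := 1) (by simpa using h)

theorem encard_nearPoints_shift_le {α β x y : ℝ} (hα : 0 < α) (hβ : 0 < β) (hx₀ : 0 ≤ x)
    (hx : x ≤ 1 / 4) (hy₀ : 0 ≤ y) (hy : y ≤ 1 / 4) {a b : ℤ} (ha : a = 0 ∨ a = 1)
    (hb : b = 0 ∨ b = 1) :
    (nearPoints α β (x, y) (x + a / 2, y + b / 2)).encard ≤ 7 := by
  rcases ha with rfl | rfl <;> rcases hb with rfl | rfl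
  · simpa using encard_nearPoints_self_le α β (x, y)
  · rw [← encard_nearPoints_swap]
    simpa using encard_nearPoints_shift_fst_le hβ hα hy₀ hy hx₀ hx
  · simpa using encard_nearPoints_shift_fst_le hα hβ hx₀ hx hy₀ hy
  · simpa using encard_nearPoints_shift_both_le hα hβ hx₀ hx hy₀ hy

theorem encard_nearPoints_swap_shift_le_of_le {α x y : ℝ} (hα : 0 < α) (hx₀ : 0 ≤ x)
    (hxy : x ≤ y) (hy : y ≤ 1 / 4) {a b : ℤ} (ha : a = 0 ∨ a = 1) (hb : b = 0 ∨ b = 1) :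
    (nearPoints α α (x, y) (y + a / 2, x + b / 2)).encard ≤ 7 := by
  by_cases hp : IsHalfLattice (x, y)
  · obtain ⟨rfl, rfl⟩ := eq_zero_of_isHalfLattice hx₀ (hxy.trans hy) (hx₀.trans hxy) hy hp
    -- At the origin exchanging the coordinates does nothing, and the translation case applies.
    exact encard_nearPoints_shift_le hα hα le_rfl (by norm_num) le_rfl (by norm_num) ha hb
  · have hy₀ : 0 < y := by
      rcases (hx₀.trans hxy).eq_or_lt with rfl | h
      · obtain rfl : x = 0 := le_antisymm hxy hx₀
        exact absurd ⟨0, 0, by simp, by simp⟩ hp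
      · exact h
    have hr : ¬ IsHalfLattice (y + a / 2, x + b / 2) := fun h => hp h.of_shift.swap
    rcases ha with rfl | rfl <;> rcases hb with rfl | rfl
    · simp only [Int.cast_zero, zero_div, add_zero] at hr ⊢
      refine encard_nearPoints_le_of_list _ ?_ hp hr fun k i j s t P Q =>
        mem_of_inOpenCell_swap hx₀ hxy hy₀ hy (P.of_eq_weights hα) (Q.of_eq_weights hα)
      simp
    · simp only [Int.cast_zero, zero_div, add_zero, Int.cast_one] at hr ⊢
      refine encard_nearPoints_le_of_list _ ?_ hp hr fun k i j s t P Q =>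
        mem_of_inOpenCell_swap_shift_snd hx₀ hxy hy₀ hy (P.of_eq_weights hα) (Q.of_eq_weights hα)
      simp
    · simp only [Int.cast_zero, zero_div, add_zero, Int.cast_one] at hr ⊢
      refine encard_nearPoints_le_of_list _ ?_ hp hr fun k i j s t P Q =>
        mem_of_inOpenCell_swap_shift_fst hx₀ hxy hy₀ hy (P.of_eq_weights hα) (Q.of_eq_weights hα)
      simp
    · simp only [Int.cast_one] at hr ⊢
      refine encard_nearPoints_le_of_list _ ?_ hp hr fun k i j s t P Q =>
        mem_of_inOpenCell_swap_shift_both hx₀ hxy hy₀ hy (P.of_eq_weights hα) (Q.of_eq_weights hα)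
      simp

theorem encard_nearPoints_swap_shift_le {α x y : ℝ} (hα : 0 < α) (hx₀ : 0 ≤ x)
    (hx : x ≤ 1 / 4) (hy₀ : 0 ≤ y) (hy : y ≤ 1 / 4) {a b : ℤ} (ha : a = 0 ∨ a = 1)
    (hb : b = 0 ∨ b = 1) :
    (nearPoints α α (x, y) (y + a / 2, x + b / 2)).encard ≤ 7 := by
  rcases le_total x y with h | h
  · exact encard_nearPoints_swap_shift_le_of_le hα hx₀ h hy ha hb
  · rw [← encard_nearPoints_swap]
    exact encard_nearPoints_swap_shift_le_of_le hα hy₀ h hx hb ha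

/-- The bound for a point in the fundamental rectangle of the normalizer. -/
theorem encard_nearPoints_le_of_mem_rectangle {α β x y : ℝ} {q : ℝ × ℝ} (hα : 0 < α)
    (hβ : 0 < β) (hx₀ : 0 ≤ x) (hx : x ≤ 1 / 4) (hy₀ : 0 ≤ y) (hy : y ≤ 1 / 4)
    (h : NormalizerRel α β (x, y) q) : (nearPoints α β (x, y) q).encard ≤ 7 := by
  obtain ⟨ε, δ, m, n, hε, hδ, rfl | ⟨rfl, rfl⟩⟩ := h
  · obtain ⟨a, b, ha, hb, hab⟩ := exists_mem_coordOrbit_shift x y m n hε hδ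
    rw [nearPoints_congr _ _ _ hab]
    exact encard_nearPoints_shift_le hα hβ hx₀ hx hy₀ hy ha hb
  · obtain ⟨a, b, ha, hb, hab⟩ := exists_mem_coordOrbit_shift y x m n hε hδ
    rw [nearPoints_congr _ _ _ hab]
    exact encard_nearPoints_swap_shift_le hα hx₀ hx hy₀ hy ha hb

theorem neg_eq_one_or {ε : ℝ} (h : ε = 1 ∨ ε = -1) : -ε = 1 ∨ -ε = -1 := by
  rcases h with rfl | rfl <;> simp

theorem NormalizerRel.swap {α β : ℝ} {p q : ℝ × ℝ} (h : NormalizerRel α β p q) :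
    NormalizerRel β α p.swap q.swap := by
  obtain ⟨ε, δ, m, n, hε, hδ, rfl | ⟨rfl, rfl⟩⟩ := h
  · exact ⟨δ, ε, n, m, hδ, hε, Or.inl rfl⟩
  · exact ⟨δ, ε, n, m, hδ, hε, Or.inr ⟨rfl, rfl⟩⟩

theorem NormalizerRel.negFst {α β : ℝ} {p q : ℝ × ℝ} (h : NormalizerRel α β p q) :
    NormalizerRel α β (negFst p) (negFst q) := by
  obtain ⟨ε, δ, m, n, hε, hδ, rfl | ⟨rfl, rfl⟩⟩ := h
  · refine ⟨ε, δ, -m, n, hε, hδ, Or.inl ?_⟩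
    ext <;> simp [PlaneGroup.negFst]
    ring
  · refine ⟨-ε, -δ, -m, n, neg_eq_one_or hε, neg_eq_one_or hδ, Or.inr ⟨rfl, ?_⟩⟩
    ext <;> simp [PlaneGroup.negFst]
    ring

theorem NormalizerRel.shift {α β : ℝ} {p q : ℝ × ℝ} (h : NormalizerRel α β p q) (k l : ℤ) :
    NormalizerRel α β (p + ((k : ℝ) / 2, (l : ℝ) / 2)) (q + ((k : ℝ) / 2, (l : ℝ) / 2)) := by
  have aux : ∀ {ε : ℝ}, (ε = 1 ∨ ε = -1) → ∀ i : ℤ, ∃ j : ℤ, ε * i = j := by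
    rintro ε (rfl | rfl) i
    · exact ⟨i, by simp⟩
    · exact ⟨-i, by simp⟩
  obtain ⟨ε, δ, m, n, hε, hδ, rfl | ⟨rfl, rfl⟩⟩ := h
  · obtain ⟨i, hi⟩ := aux hε k
    obtain ⟨j, hj⟩ := aux hδ l
    refine ⟨ε, δ, m + k - i, n + l - j, hε, hδ, Or.inl ?_⟩
    ext <;> simp only [Prod.fst_add, Prod.snd_add] <;> push_cast <;> linarith
  · obtain ⟨i, hi⟩ := aux hε l
    obtain ⟨j, hj⟩ := aux hδ k
    refine ⟨ε, δ, m + k - i, n + l - j, hε, hδ, Or.inr ⟨rfl, ?_⟩⟩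
    ext <;> simp only [Prod.fst_add, Prod.snd_add] <;> push_cast <;> linarith

theorem encard_nearPoints_le_of_snd_nonneg {α β x y : ℝ} {q : ℝ × ℝ} (hα : 0 < α) (hβ : 0 < β)
    (hx : |x| ≤ 1 / 4) (hy₀ : 0 ≤ y) (hy : y ≤ 1 / 4) (h : NormalizerRel α β (x, y) q) :
    (nearPoints α β (x, y) q).encard ≤ 7 := by
  rw [abs_le] at hx
  rcases le_total 0 x with hx₀ | hx₀
  · exact encard_nearPoints_le_of_mem_rectangle hα hβ hx₀ hx.2 hy₀ hy h
  · rw [← encard_nearPoints_negFst]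
    exact encard_nearPoints_le_of_mem_rectangle hα hβ (neg_nonneg.2 hx₀)
      (show -x ≤ 1 / 4 by linarith) hy₀ hy h.negFst

theorem encard_nearPoints_le_of_abs_le {α β x y : ℝ} {q : ℝ × ℝ} (hα : 0 < α) (hβ : 0 < β)
    (hx : |x| ≤ 1 / 4) (hy : |y| ≤ 1 / 4) (h : NormalizerRel α β (x, y) q) :
    (nearPoints α β (x, y) q).encard ≤ 7 := by
  rcases le_total 0 y with hy₀ | hy₀
  · exact encard_nearPoints_le_of_snd_nonneg hα hβ hx hy₀ (le_of_abs_le hy) h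
  · rw [← encard_nearPoints_swap, ← encard_nearPoints_negFst, ← encard_nearPoints_swap]
    refine encard_nearPoints_le_of_snd_nonneg hα hβ hx (neg_nonneg.2 hy₀) ?_ h.swap.negFst.swap
    rw [abs_le] at hy
    show -y ≤ 1 / 4
    linarith

theorem exists_abs_add_half_le (x : ℝ) : ∃ m : ℤ, |x + m / 2| ≤ 1 / 4 := by
  refine ⟨-round (2 * x), ?_⟩
  have h := abs_sub_round (2 * x)
  rw [abs_le] at h ⊢
  push_cast
  constructor <;> linarith

theorem encard_nearPoints_le {α β : ℝ} {p q : ℝ × ℝ} (hα : 0 < α) (hβ : 0 < β)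
    (h : NormalizerRel α β p q) : (nearPoints α β p q).encard ≤ 7 := by
  obtain ⟨m, hm⟩ := exists_abs_add_half_le p.1
  obtain ⟨n, hn⟩ := exists_abs_add_half_le p.2
  rw [← encard_nearPoints_shift α β p q m n]
  exact encard_nearPoints_le_of_abs_le hα hβ hm hn (h.shift m n)

/-! ### The plane and the group in coordinates -/

/-- The point with coordinates `r` with respect to the origin `c` and the vectors `u`, `v`. -/
noncomputable def framePoint (c u v : EuclPlane) (r : ℝ × ℝ) : EuclPlane :=
  c + (r.1 • u + r.2 • v)

theorem translation_apply (w x : EuclPlane) : translation w x = w + x :=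
  rfl

theorem halfTurn_apply (c x : EuclPlane) : halfTurn c x = c - x + c :=
  rfl

theorem translation_add (w w' : EuclPlane) :
    translation (w + w') = translation w * translation w' := by
  ext1 x
  simp only [AffineIsometryEquiv.coe_mul, Function.comp_apply, translation_apply, add_assoc]

theorem translation_neg (w : EuclPlane) : translation (-w) = (translation w)⁻¹ := by
  rw [eq_inv_iff_mul_eq_one, ← translation_add, neg_add_cancel]
  ext1 x
  simp [translation_apply]

theorem translation_zsmul_mem {G : Subgroup PlaneIsom} {w : EuclPlane} (h : translation w ∈ G)
    (i : ℤ) : translation ((i : ℝ) • w) ∈ G := by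
  induction i using Int.induction_on with
  | zero =>
    have : translation (((0 : ℤ) : ℝ) • w) = 1 := by
      ext1 x
      simp [translation_apply]
    rw [this]
    exact G.one_mem
  | succ i ih =>
    rw [Int.cast_add, add_smul, translation_add, Int.cast_one, one_smul]
    exact G.mul_mem ih h
  | pred i ih =>
    have e : ((-(i : ℤ) - 1 : ℤ) : ℝ) • w = ((-(i : ℤ) : ℤ) : ℝ) • w + -w := by
      push_cast
      module
    rw [e, translation_add, translation_neg]
    exact G.mul_mem ih (G.inv_mem h)

section Frame

variable {c u v : EuclPlane}

theorem norm_framePoint_sq (huv : inner ℝ u v = 0) (a b : ℝ) :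
    ‖a • u + b • v‖ ^ 2 = ‖u‖ ^ 2 * a ^ 2 + ‖v‖ ^ 2 * b ^ 2 := by
  rw [norm_add_sq_real, inner_smul_left, inner_smul_right, huv, norm_smul, norm_smul,
    Real.norm_eq_abs, Real.norm_eq_abs, mul_pow, mul_pow, sq_abs, sq_abs]
  simp only [mul_zero, add_zero]
  ring

theorem framePoint_sub (p q : ℝ × ℝ) :
    framePoint c u v p - framePoint c u v q = (p.1 - q.1) • u + (p.2 - q.2) • v := by
  unfold framePoint
  module

theorem dist_framePoint_sq (huv : inner ℝ u v = 0) (p z : ℝ × ℝ) :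
    dist (framePoint c u v z) (framePoint c u v p) ^ 2 = coordDist (‖u‖ ^ 2) (‖v‖ ^ 2) p z := by
  rw [dist_eq_norm, framePoint_sub, norm_framePoint_sq huv, coordDist]

theorem framePoint_injective (hu : u ≠ 0) (hv : v ≠ 0) (huv : inner ℝ u v = 0) :
    Function.Injective (framePoint c u v) := by
  intro p q h
  have h₁ := dist_framePoint_sq (c := c) huv q p
  rw [h, dist_self, coordDist] at h₁
  have hu' : 0 < ‖u‖ ^ 2 := by positivity
  have hv' : 0 < ‖v‖ ^ 2 := by positivity
  have k₁ : (p.1 - q.1) ^ 2 = 0 := by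
    nlinarith [mul_nonneg hu'.le (sq_nonneg (p.1 - q.1)), mul_nonneg hv'.le (sq_nonneg (p.2 - q.2))]
  have k₂ : (p.2 - q.2) ^ 2 = 0 := by
    nlinarith [mul_nonneg hu'.le (sq_nonneg (p.1 - q.1)), mul_nonneg hv'.le (sq_nonneg (p.2 - q.2))]
  ext
  · linarith [pow_eq_zero_iff two_ne_zero |>.1 k₁]
  · linarith [pow_eq_zero_iff two_ne_zero |>.1 k₂]

theorem framePoint_surjective (hu : u ≠ 0) (hv : v ≠ 0) (huv : inner ℝ u v = 0) :
    Function.Surjective (framePoint c u v) := by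
  have hli : LinearIndependent ℝ ![u, v] := by
    refine linearIndependent_of_ne_zero_of_inner_eq_zero (𝕜 := ℝ) ?_ ?_
    · intro i
      fin_cases i <;> simpa
    · intro i j hij
      fin_cases i <;> fin_cases j <;> simp_all [real_inner_comm]
  have hspan := hli.span_eq_top_of_card_eq_finrank (by simp)
  intro x
  have hx : x - c ∈ Submodule.span ℝ (Set.range ![u, v]) := hspan ▸ Submodule.mem_top
  rw [Matrix.range_cons, Matrix.range_cons, Matrix.range_empty, Set.union_empty,
    Set.singleton_union, Submodule.mem_span_pair] at hx
  obtain ⟨a, b, hab⟩ := hx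
  exact ⟨(a, b), by simp [framePoint, hab]⟩

/-- An isometry acts in coordinates as one of the elements of a `pgg` group. -/
def ActsAs (c u v : EuclPlane) (g : PlaneIsom) (t : Fin 4 × ℤ × ℤ) : Prop :=
  ∀ r, g (framePoint c u v r) = framePoint c u v (orbitPoint r t)

theorem actsAs_translation (i j : ℤ) :
    ActsAs c u v (translation ((i : ℝ) • u + (j : ℝ) • v)) (0, i, j) := by
  intro r
  simp only [translation_apply, framePoint, orbitPoint]
  module

theorem actsAs_halfTurn : ActsAs c u v (halfTurn c) (1, 0, 0) := by
  intro r
  simp only [halfTurn_apply, framePoint, orbitPoint]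
  push_cast
  module

theorem actsAs_glideReflection (huv : inner ℝ u v = 0) :
    ActsAs c u v (glideReflection (c + (1 / 4 : ℝ) • v) ((1 / 2 : ℝ) • u)) (2, 0, 0) := by
  intro r
  -- The foot of the perpendicular to the axis has second coordinate `1/4`, so reflection turns
  -- `r.2` into `1/2 - r.2`.
  have hp : r.1 • u +ᵥ (c + (1 / 4 : ℝ) • v) ∈
      AffineSubspace.mk' (c + (1 / 4 : ℝ) • v) (Submodule.span ℝ {(1 / 2 : ℝ) • u}) := by
    refine AffineSubspace.vadd_mem_mk' _ (Submodule.mem_span_singleton.2 ⟨2 * r.1, ?_⟩)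
    module
  have hv : (r.2 - 1 / 4) • v ∈ (AffineSubspace.mk' (c + (1 / 4 : ℝ) • v)
      (Submodule.span ℝ {(1 / 2 : ℝ) • u})).directionᗮ := by
    rw [AffineSubspace.direction_mk', Submodule.mem_orthogonal_singleton_iff_inner_right,
      inner_smul_left, inner_smul_right, huv]
    simp
  have h := EuclideanGeometry.reflection_orthogonal_vadd hp hv
  have e : framePoint c u v r = (r.2 - 1 / 4) • v +ᵥ (r.1 • u +ᵥ (c + (1 / 4 : ℝ) • v)) := by
    simp only [framePoint, vadd_eq_add]
    module
  rw [glideReflection, AffineIsometryEquiv.coe_mul, Function.comp_apply, translation_apply]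
  rw [e, h]
  simp only [framePoint, vadd_eq_add, orbitPoint]
  push_cast
  module

theorem ActsAs.mul {g h : PlaneIsom} {t t' : Fin 4 × ℤ × ℤ} (hg : ActsAs c u v g t')
    (hh : ActsAs c u v h t) : ∃ t'', ActsAs c u v (g * h) t'' := by
  obtain ⟨t'', ht⟩ := exists_orbitPoint_comp t t'
  refine ⟨t'', fun r => ?_⟩
  rw [AffineIsometryEquiv.coe_mul, Function.comp_apply, hh, hg, ht]

theorem ActsAs.inv {g : PlaneIsom} {t : Fin 4 × ℤ × ℤ} (hg : ActsAs c u v g t) :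
    ∃ t', ActsAs c u v g⁻¹ t' := by
  obtain ⟨t', ht⟩ := exists_orbitPoint_inv t
  obtain ⟨t'', ht'⟩ := exists_orbitPoint_inv t'
  refine ⟨t', fun r => ?_⟩
  -- `t'` undoes `t` from one side only; since `t''` in turn undoes `t'`, the inverse is two-sided.
  have e : orbitPoint (orbitPoint r t') t = r := by
    have := ht (orbitPoint r t')
    have h2 := congrArg (fun s => orbitPoint s t'') this
    simp only [ht'] at h2
    exact h2
  apply g.injective
  rw [hg, e]
  exact g.apply_symm_apply _

/-- The `pgg` group with half-turn centre `c` and translation vectors `u`, `v`. -/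
noncomputable def pggGroup (c u v : EuclPlane) : Subgroup PlaneIsom :=
  Subgroup.closure {translation u, translation v, halfTurn c,
    glideReflection (c + (1 / 4 : ℝ) • v) ((1 / 2 : ℝ) • u)}

theorem exists_actsAs_of_mem (huv : inner ℝ u v = 0) {g : PlaneIsom} (hg : g ∈ pggGroup c u v) :
    ∃ t, ActsAs c u v g t := by
  induction hg using Subgroup.closure_induction with
  | mem g hg =>
    rcases hg with rfl | rfl | rfl | rfl
    · exact ⟨(0, 1, 0), by simpa using actsAs_translation (c := c) (u := u) (v := v) 1 0⟩
    · exact ⟨(0, 0, 1), by simpa using actsAs_translation (c := c) (u := u) (v := v) 0 1⟩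
    · exact ⟨_, actsAs_halfTurn⟩
    · exact ⟨_, actsAs_glideReflection huv⟩
  | one => exact ⟨(0, 0, 0), fun r => by simp [orbitPoint]⟩
  | mul g h _ _ ihg ihh =>
    obtain ⟨t, ht⟩ := ihg
    obtain ⟨t', ht'⟩ := ihh
    exact ht.mul ht'
  | inv g _ ih =>
    obtain ⟨t, ht⟩ := ih
    exact ht.inv

theorem translation_fst_mem : translation u ∈ pggGroup c u v :=
  Subgroup.subset_closure (by simp)

theorem translation_snd_mem : translation v ∈ pggGroup c u v :=
  Subgroup.subset_closure (by simp)

theorem halfTurn_mem : halfTurn c ∈ pggGroup c u v :=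
  Subgroup.subset_closure (by simp)

theorem glideReflection_mem :
    glideReflection (c + (1 / 4 : ℝ) • v) ((1 / 2 : ℝ) • u) ∈ pggGroup c u v :=
  Subgroup.subset_closure (by simp)

theorem exists_mem_actsAs (huv : inner ℝ u v = 0) (t : Fin 4 × ℤ × ℤ) :
    ∃ g ∈ pggGroup c u v, ActsAs c u v g t := by
  obtain ⟨k, i, j⟩ := t
  have ht : translation ((i : ℝ) • u + (j : ℝ) • v) ∈ pggGroup c u v := by
    rw [translation_add]
    exact mul_mem (translation_zsmul_mem translation_fst_mem i)
      (translation_zsmul_mem translation_snd_mem j)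
  have hG := glideReflection_mem (c := c) (u := u) (v := v)
  have hH := halfTurn_mem (c := c) (u := u) (v := v)
  match k with
  | 0 => exact ⟨_, ht, actsAs_translation i j⟩
  | 1 =>
    refine ⟨_, mul_mem ht hH, fun r => ?_⟩
    rw [AffineIsometryEquiv.coe_mul, Function.comp_apply, actsAs_halfTurn, actsAs_translation]
    simp [orbitPoint]
  | 2 =>
    refine ⟨_, mul_mem ht hG, fun r => ?_⟩
    rw [AffineIsometryEquiv.coe_mul, Function.comp_apply, actsAs_glideReflection huv,
      actsAs_translation]
    simp [orbitPoint]
  | 3 =>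
    -- The fourth family is the half-turn followed by the glide reflection.
    refine ⟨_, mul_mem ht (mul_mem hG hH), fun r => ?_⟩
    rw [AffineIsometryEquiv.coe_mul, Function.comp_apply, AffineIsometryEquiv.coe_mul,
      Function.comp_apply, actsAs_halfTurn, actsAs_glideReflection huv, actsAs_translation]
    congr 1
    ext <;> simp [orbitPoint]
    ring

theorem orbit_framePoint (huv : inner ℝ u v = 0) (r : ℝ × ℝ) :
    orbit (pggGroup c u v) (framePoint c u v r) = framePoint c u v '' coordOrbit r := by
  ext x
  constructor
  · rintro ⟨g, hg, rfl⟩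
    obtain ⟨t, ht⟩ := exists_actsAs_of_mem huv hg
    exact ⟨_, ⟨t, rfl⟩, (ht r).symm⟩
  · rintro ⟨_, ⟨t, rfl⟩, rfl⟩
    obtain ⟨g, hg, ht⟩ := exists_mem_actsAs (c := c) huv t
    exact ⟨g, hg, ht r⟩

/-! ### The normalizer in coordinates -/

/-- The four families have different linear parts; the values at `(0, 0)`, `(1, 0)` and `(0, 1)`
tell them apart, and only the first is a translation. -/
theorem orbitPoint_eq_add {t : Fin 4 × ℤ × ℤ} {w : ℝ × ℝ} (h : ∀ r, orbitPoint r t = r + w) :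
    ∃ i j : ℤ, w = ((i : ℝ), (j : ℝ)) := by
  obtain ⟨k, i, j⟩ := t
  have h₀ := h (0, 0)
  have h₁ := h (1, 0)
  have h₂ := h (0, 1)
  match k with
  | 0 =>
    refine ⟨i, j, ?_⟩
    simpa [orbitPoint] using (h 0).symm
  | 1 =>
    simp only [orbitPoint, Prod.ext_iff, Prod.fst_add, Prod.snd_add] at h₀ h₁ h₂
    linarith [h₀.1, h₁.1]
  | 2 =>
    simp only [orbitPoint, Prod.ext_iff, Prod.fst_add, Prod.snd_add] at h₀ h₁ h₂
    linarith [h₀.2, h₂.2]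
  | 3 =>
    simp only [orbitPoint, Prod.ext_iff, Prod.fst_add, Prod.snd_add] at h₀ h₁ h₂
    linarith [h₀.1, h₁.1]

theorem orbitPoint_eq_sub {t : Fin 4 × ℤ × ℤ} {w : ℝ × ℝ} (h : ∀ r, orbitPoint r t = w - r) :
    ∃ i j : ℤ, w = ((i : ℝ), (j : ℝ)) := by
  obtain ⟨k, i, j⟩ := t
  have h₀ := h (0, 0)
  have h₁ := h (1, 0)
  have h₂ := h (0, 1)
  match k with
  | 0 =>
    simp only [orbitPoint, Prod.ext_iff, Prod.fst_sub, Prod.snd_sub] at h₀ h₁ h₂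
    linarith [h₀.1, h₁.1]
  | 1 =>
    refine ⟨i, j, ?_⟩
    simpa [orbitPoint] using (h 0).symm
  | 2 =>
    simp only [orbitPoint, Prod.ext_iff, Prod.fst_sub, Prod.snd_sub] at h₀ h₁ h₂
    linarith [h₀.1, h₁.1]
  | 3 =>
    simp only [orbitPoint, Prod.ext_iff, Prod.fst_sub, Prod.snd_sub] at h₀ h₁ h₂
    linarith [h₀.2, h₂.2]

/-- The translations in a `pgg` group are those by the lattice vectors. -/
theorem lattice_of_translation_mem (hu : u ≠ 0) (hv : v ≠ 0) (huv : inner ℝ u v = 0)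
    {w : EuclPlane} (h : translation w ∈ pggGroup c u v) :
    ∃ i j : ℤ, w = (i : ℝ) • u + (j : ℝ) • v := by
  obtain ⟨t, ht⟩ := exists_actsAs_of_mem huv h
  obtain ⟨a, ha⟩ := framePoint_surjective (c := 0) hu hv huv w
  have hadd : ∀ r, orbitPoint r t = r + a := by
    intro r
    apply framePoint_injective (c := c) hu hv huv
    rw [← ht r, translation_apply, ← ha]
    simp only [framePoint, Prod.fst_add, Prod.snd_add]
    module
  obtain ⟨i, j, rfl⟩ := orbitPoint_eq_add hadd
  exact ⟨i, j, by rw [← ha]; simp [framePoint]⟩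

/-- The half-turns in a `pgg` group have their centres in the half-lattice. -/
theorem half_lattice_of_halfTurn_mem (hu : u ≠ 0) (hv : v ≠ 0) (huv : inner ℝ u v = 0)
    {p : EuclPlane} (h : halfTurn p ∈ pggGroup c u v) :
    ∃ i j : ℤ, p = framePoint c u v ((i : ℝ) / 2, (j : ℝ) / 2) := by
  obtain ⟨t, ht⟩ := exists_actsAs_of_mem huv h
  obtain ⟨a, rfl⟩ := framePoint_surjective (c := c) hu hv huv p
  have hsub : ∀ r, orbitPoint r t = a + a - r := by
    intro r
    apply framePoint_injective (c := c) hu hv huv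
    rw [← ht r, halfTurn_apply]
    simp only [framePoint, Prod.fst_add, Prod.snd_add, Prod.fst_sub, Prod.snd_sub]
    module
  obtain ⟨i, j, hij⟩ := orbitPoint_eq_sub hsub
  refine ⟨i, j, congrArg _ ?_⟩
  rw [Prod.ext_iff] at hij ⊢
  simp only [Prod.fst_add, Prod.snd_add] at hij ⊢
  exact ⟨by linarith [hij.1], by linarith [hij.2]⟩

theorem conj_translation (τ : PlaneIsom) (w : EuclPlane) :
    τ * translation w * τ⁻¹ = translation (τ.linearIsometryEquiv w) := by
  ext1 x
  obtain ⟨x, rfl⟩ := τ.surjective x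
  have : τ⁻¹ (τ x) = x := τ.symm_apply_apply x
  simp only [AffineIsometryEquiv.coe_mul, Function.comp_apply, this, translation_apply]
  exact τ.map_vadd x w

theorem conj_halfTurn (τ : PlaneIsom) (c : EuclPlane) :
    τ * halfTurn c * τ⁻¹ = halfTurn (τ c) := by
  ext1 x
  obtain ⟨x, rfl⟩ := τ.surjective x
  have : τ⁻¹ (τ x) = x := τ.symm_apply_apply x
  simp only [AffineIsometryEquiv.coe_mul, Function.comp_apply, this]
  have h := τ.map_vadd c (c -ᵥ x)
  rw [τ.map_vsub] at h
  exact h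

end Frame

section Frame

variable {c u v : EuclPlane}

/-- A linear isometry preserving a rectangular lattice permutes its two axes up to sign. -/
theorem rectangular_lattice_isometry {α β : ℝ} (hα : 0 < α) (hβ : 0 < β) {i j k l : ℤ}
    (h₁ : α * (i : ℝ) ^ 2 + β * (j : ℝ) ^ 2 = α) (h₂ : α * (k : ℝ) ^ 2 + β * (l : ℝ) ^ 2 = β)
    (h₃ : α * ((i : ℝ) * k) + β * ((j : ℝ) * l) = 0) :
    ((i : ℝ) ^ 2 = 1 ∧ (j : ℝ) = 0 ∧ (k : ℝ) = 0 ∧ (l : ℝ) ^ 2 = 1) ∨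
      (α = β ∧ (i : ℝ) = 0 ∧ (j : ℝ) ^ 2 = 1 ∧ (k : ℝ) ^ 2 = 1 ∧ (l : ℝ) = 0) := by
  have one_le : ∀ {m : ℤ}, m ≠ 0 → (1 : ℝ) ≤ (m : ℝ) ^ 2 := by
    intro m hm
    have : 1 ≤ m ^ 2 := by
      have : 0 < m ^ 2 := by positivity
      omega
    exact_mod_cast this
  by_cases hj : j = 0
  · subst hj
    left
    have hi : (i : ℝ) ^ 2 = 1 := by
      apply mul_left_cancel₀ hα.ne'
      simpa using h₁
    have hi₀ : (i : ℝ) ≠ 0 := fun h => by norm_num [h] at hi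
    have hk : (k : ℝ) = 0 := by simpa [hα.ne', hi₀] using h₃
    refine ⟨hi, by simp, hk, ?_⟩
    apply mul_left_cancel₀ hβ.ne'
    simpa [hk] using h₂
  · right
    have hj₁ := one_le hj
    -- If both `i` and `j` were nonzero, the left side of `h₁` would be at least `α + β`.
    have hi : i = 0 := by
      by_contra hi
      nlinarith [one_le hi]
    subst hi
    have hj₀ : (j : ℝ) ≠ 0 := by exact_mod_cast hj
    have hl : (l : ℝ) = 0 := by simpa [hβ.ne', hj₀] using h₃
    have e₁ : β * (j : ℝ) ^ 2 = α := by simpa using h₁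
    have e₂ : α * (k : ℝ) ^ 2 = β := by simpa [hl] using h₂
    have hk : k ≠ 0 := by
      rintro rfl
      simp only [Int.cast_zero, ne_eq, OfNat.ofNat_ne_zero, not_false_eq_true, zero_pow,
        mul_zero] at e₂
      linarith
    -- `e₁` gives `β ≤ α` and `e₂` gives `α ≤ β`.
    have hαβ : α = β := by nlinarith [one_le hk]
    subst hαβ
    refine ⟨rfl, by simp, ?_, ?_, hl⟩
    · exact mul_left_cancel₀ hα.ne' (by rw [e₁, mul_one])
    · exact mul_left_cancel₀ hα.ne' (by rw [e₂, mul_one])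

/-- The elements of the normalizer of a `pgg` group, in coordinates. -/
theorem normalizerRel_of_mem_normalizer (hu : u ≠ 0) (hv : v ≠ 0) (huv : inner ℝ u v = 0)
    {τ : PlaneIsom} (hτ : τ ∈ Subgroup.normalizer (pggGroup c u v : Set PlaneIsom)) (p : ℝ × ℝ) :
    ∃ q, τ (framePoint c u v p) = framePoint c u v q ∧
      NormalizerRel (‖u‖ ^ 2) (‖v‖ ^ 2) p q := by
  rw [Subgroup.mem_set_normalizer_iff] at hτ
  have hU := (hτ _).1 (translation_fst_mem (c := c) (u := u) (v := v))
  have hV := (hτ _).1 (translation_snd_mem (c := c) (u := u) (v := v))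
  have hC := (hτ _).1 (halfTurn_mem (c := c) (u := u) (v := v))
  rw [conj_translation] at hU hV
  rw [conj_halfTurn] at hC
  obtain ⟨i, j, hij⟩ := lattice_of_translation_mem hu hv huv hU
  obtain ⟨k, l, hkl⟩ := lattice_of_translation_mem hu hv huv hV
  obtain ⟨m, n, hmn⟩ := half_lattice_of_halfTurn_mem hu hv huv hC
  have hτp : τ (framePoint c u v p) = framePoint c u v
      (p.1 * i + p.2 * k + m / 2, p.1 * j + p.2 * l + n / 2) := by
    have h := τ.map_vadd c (p.1 • u + p.2 • v)
    rw [map_add, map_smul, map_smul, hij, hkl, hmn] at h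
    rw [framePoint, add_comm c]
    refine h.trans ?_
    simp only [framePoint, vadd_eq_add]
    module
  have h₁ : ‖u‖ ^ 2 * (i : ℝ) ^ 2 + ‖v‖ ^ 2 * (j : ℝ) ^ 2 = ‖u‖ ^ 2 := by
    rw [← norm_framePoint_sq huv, ← hij, LinearIsometryEquiv.norm_map]
  have h₂ : ‖u‖ ^ 2 * (k : ℝ) ^ 2 + ‖v‖ ^ 2 * (l : ℝ) ^ 2 = ‖v‖ ^ 2 := by
    rw [← norm_framePoint_sq huv, ← hkl, LinearIsometryEquiv.norm_map]
  have h₃ : ‖u‖ ^ 2 * ((i : ℝ) * k) + ‖v‖ ^ 2 * ((j : ℝ) * l) = 0 := by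
    have h := τ.linearIsometryEquiv.inner_map_map u v
    rw [hij, hkl, huv] at h
    simp only [inner_add_left, inner_add_right, inner_smul_left, inner_smul_right,
      real_inner_self_eq_norm_sq, huv, real_inner_comm u v, conj_trivial] at h
    linarith
  refine ⟨_, hτp, ?_⟩
  rcases rectangular_lattice_isometry (by positivity) (by positivity) h₁ h₂ h₃ with
    ⟨hi, hj, hk, hl⟩ | ⟨he, hi, hj, hk, hl⟩
  · exact ⟨i, l, m, n, sq_eq_one_iff.1 hi, sq_eq_one_iff.1 hl,
      Or.inl (by rw [hj, hk]; ext <;> simp [mul_comm])⟩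
  · exact ⟨k, j, m, n, sq_eq_one_iff.1 hk, sq_eq_one_iff.1 hj,
      Or.inr ⟨he, by rw [hi, hl]; ext <;> simp [mul_comm]⟩⟩

/-! ### Dirichlet regions and the conclusion -/

/-- In the interior of a Dirichlet region the defining inequalities are strict. -/
theorem dist_lt_of_mem_interior {S : Set EuclPlane} {p q z : EuclPlane}
    (hz : z ∈ interior (dirichletRegion S p)) (hq : q ∈ S) (hne : q ≠ p) :
    dist z p < dist z q := by
  by_contra! hle
  -- A small move from `z` in the direction `q - p` stays in the region, yet if `z` were no farther
  -- from `q` than from `p` it would end strictly closer to `q`.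
  have hcont : Filter.Tendsto (fun ε : ℝ => z + ε • (q - p)) (nhdsWithin 0 (Set.Ioi 0))
      (nhds z) := by
    have h : Continuous fun ε : ℝ => z + ε • (q - p) := by fun_prop
    have h0 := h.tendsto 0
    simp only [zero_smul, add_zero] at h0
    exact h0.mono_left nhdsWithin_le_nhds
  have hev := (hcont.eventually (mem_interior_iff_mem_nhds.1 hz)).and self_mem_nhdsWithin
  obtain ⟨ε, hε, hpos⟩ := hev.exists
  have hd := hε q hq
  have hpos : 0 < ε := hpos
  rw [dist_eq_norm, dist_eq_norm] at hd hle
  have e₁ : z + ε • (q - p) - p = (z - p) + ε • (q - p) := by abel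
  have e₂ : z + ε • (q - p) - q = (z - p) + (ε - 1) • (q - p) := by module
  have e₃ : z - q = (z - p) - (q - p) := by abel
  rw [e₁, e₂] at hd
  rw [e₃] at hle
  have hd2 := pow_le_pow_left₀ (norm_nonneg _) hd 2
  have hle2 := pow_le_pow_left₀ (norm_nonneg _) hle 2
  rw [norm_add_sq_real, norm_add_sq_real, norm_smul, norm_smul, inner_smul_right,
    inner_smul_right, mul_pow, mul_pow, Real.norm_eq_abs, Real.norm_eq_abs, sq_abs, sq_abs] at hd2
  rw [norm_sub_sq_real] at hle2
  have hqp : 0 < ‖q - p‖ ^ 2 := by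
    have : 0 < ‖q - p‖ := norm_pos_iff.2 (sub_ne_zero.2 hne)
    positivity
  nlinarith [mul_pos hpos hqp]

theorem isStrictlyNearest_of_mem_interior (huv : inner ℝ u v = 0) {r p z : ℝ × ℝ}
    (h : framePoint c u v z ∈
      interior (dirichletRegion (framePoint c u v '' coordOrbit r) (framePoint c u v p)))
    (hinj : Function.Injective (framePoint c u v)) :
    IsStrictlyNearest (‖u‖ ^ 2) (‖v‖ ^ 2) (coordOrbit r) p z := by
  intro s hs hne
  have hlt := dist_lt_of_mem_interior h (Set.mem_image_of_mem _ hs) (hinj.ne hne)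
  rw [← dist_framePoint_sq (c := c) huv, ← dist_framePoint_sq (c := c) huv]
  exact pow_lt_pow_left₀ hlt dist_nonneg two_ne_zero

theorem encard_overlap_le (hu : u ≠ 0) (hv : v ≠ 0) (huv : inner ℝ u v = 0) {P : EuclPlane}
    {τ : PlaneIsom} (hτ : τ ∈ Subgroup.normalizer (pggGroup c u v : Set PlaneIsom)) :
    {R ∈ dirichletRegions (orbit (pggGroup c u v) (τ P)) |
      Overlap R (dirichletRegion (orbit (pggGroup c u v) P) P)}.encard ≤ 7 := by
  have hinj := framePoint_injective (c := c) hu hv huv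
  have hsurj := framePoint_surjective (c := c) hu hv huv
  obtain ⟨p, rfl⟩ := hsurj P
  obtain ⟨q, hq, hpq⟩ := normalizerRel_of_mem_normalizer hu hv huv hτ p
  rw [hq, orbit_framePoint huv, orbit_framePoint huv]
  have hsub : {R ∈ dirichletRegions (framePoint c u v '' coordOrbit q) |
      Overlap R (dirichletRegion (framePoint c u v '' coordOrbit p) (framePoint c u v p))} ⊆
      (fun s => dirichletRegion (framePoint c u v '' coordOrbit q) (framePoint c u v s)) ''
        nearPoints (‖u‖ ^ 2) (‖v‖ ^ 2) p q := by
    rintro _ ⟨⟨_, ⟨s, hs, rfl⟩, rfl⟩, z, hz, hz'⟩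
    obtain ⟨z, rfl⟩ := hsurj z
    exact ⟨s, ⟨hs, z, isStrictlyNearest_of_mem_interior huv hz' hinj,
      isStrictlyNearest_of_mem_interior huv hz hinj⟩, rfl⟩
  exact (Set.encard_le_encard hsub).trans ((Set.encard_image_le _ _).trans
    (encard_nearPoints_le (by positivity) (by positivity) hpq))

end Frame

theorem orbit_eq_of_mem {G : Subgroup PlaneIsom} {P P' : EuclPlane} (h : P' ∈ orbit G P) :
    orbit G P' = orbit G P := by
  obtain ⟨g, hg, rfl⟩ := h
  ext x
  constructor
  · rintro ⟨k, hk, rfl⟩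
    exact ⟨k * g, mul_mem hk hg, rfl⟩
  · rintro ⟨k, hk, rfl⟩
    refine ⟨k * g⁻¹, mul_mem hk (inv_mem hg), ?_⟩
    exact congrArg k (g.symm_apply_apply P)

theorem self_mem_orbit (G : Subgroup PlaneIsom) (P : EuclPlane) : P ∈ orbit G P :=
  ⟨1, one_mem G, rfl⟩

end PlaneGroup

theorem mainTheorem5 (G₀ : Subgroup PlaneIsom) (hG₀ : PlaneGroup.IsTypePgg G₀) :
    (∀ (P Q : EuclPlane) (τ : PlaneIsom),
      τ ∈ Subgroup.normalizer (G₀ : Set PlaneIsom) → Q = τ P →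
      {R ∈ PlaneGroup.dirichletRegions (PlaneGroup.orbit G₀ Q) |
        PlaneGroup.Overlap R
          (PlaneGroup.dirichletRegion (PlaneGroup.orbit G₀ P) P)}.encard ≤ 7) ∧
    (∀ P Q X : EuclPlane,
      PlaneGroup.orbit G₀ P ∪ PlaneGroup.orbit G₀ Q ⊆
        PlaneGroup.orbit (Subgroup.normalizer (G₀ : Set PlaneIsom)) X →
      ∀ D ∈ PlaneGroup.dirichletRegions (PlaneGroup.orbit G₀ P),
        {R ∈ PlaneGroup.dirichletRegions (PlaneGroup.orbit G₀ Q) |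
          PlaneGroup.Overlap R D}.encard ≤ 7) := by
  obtain ⟨c, u, v, hu, hv, huv, rfl⟩ := hG₀
  have key : ∀ (P Q : EuclPlane) (τ : PlaneIsom),
      τ ∈ Subgroup.normalizer (PlaneGroup.pggGroup c u v : Set PlaneIsom) → Q = τ P →
      {R ∈ PlaneGroup.dirichletRegions (PlaneGroup.orbit (PlaneGroup.pggGroup c u v) Q) |
        PlaneGroup.Overlap R (PlaneGroup.dirichletRegion
          (PlaneGroup.orbit (PlaneGroup.pggGroup c u v) P) P)}.encard ≤ 7 := by
    rintro P _ τ hτ rfl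
    exact PlaneGroup.encard_overlap_le hu hv huv hτ
  refine ⟨key, ?_⟩
  rintro P Q X hX _ ⟨P', hP', rfl⟩
  obtain ⟨σ, hσ, hσX⟩ := hX (Or.inl hP')
  obtain ⟨ρ, hρ, hρX⟩ := hX (Or.inr (PlaneGroup.self_mem_orbit _ Q))
  rw [← PlaneGroup.orbit_eq_of_mem hP']
  -- Any region of the first orbit may be recentred at its own point `P' = σ X`, and `ρ * σ⁻¹` then
  -- carries `P'` to `Q = ρ X`.
  refine key P' Q (ρ * σ⁻¹) (mul_mem hρ (inv_mem hσ)) ?_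
  rw [← hρX, ← hσX]
  exact congrArg ρ (σ.symm_apply_apply X).symm
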